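/- Let $\mu>0$, $g>0$, and let $\bar\rho\in C^\infty(\mathbb R)$ satisfy $\bar\rho'\in C_0^\infty(\mathbb R)$, $\inf_{\mathbb R}\bar\rho>0$ and $\bar\rho'(x_3^0)>0$ for some $x_3^0\in\mathbb R$. Then there are a function $\lambda:(0,\infty)\to(0,\infty)$ and, for every $\xi=(\xi_1,\xi_2)\in\mathbb R^2$ with $|\xi|>0$, real-valued smooth functions $\varphi=\varphi(\xi,\cdot)$, $\theta=\theta(\xi,\cdot)$, $\psi=\psi(|\xi|,\cdot)$, $\pi=\pi(|\xi|,\cdot)$ on $\mathbb R$, where $\psi$ and $\pi$ depend on $\xi$ only through $|\xi|$ and $\psi\not\equiv 0$, such that with $\lambda=\lambda(|\xi|)>0$ and $'=d/dx_3$ $$\begin{cases} \lambda^2\bar\rho\,\varphi-\lambda\xi_1\pi+\lambda\mu(|\xi|^2\varphi-\varphi'')=0,\\ \lambda^2\bar\rho\,\theta-\lambda\xi_2\pi+\lambda\mu(|\xi|^2\theta-\theta'')=0,\\ \lambda^2\bar\rho\,\psi+\lambda\pi'+\lambda\mu(|\xi|^2\psi-\psi'')=g\bar\rho'\psi,\\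 \xi_1\varphi+\xi_2\theta+\psi'=0 \end{cases}$$ on $\mathbb R$, the functions $\varphi,\theta,\psi$ tend to $0$ as $x_3\to-\infty$ and as $x_3\to+\infty$, and $\varphi,\theta,\psi,\pi\in H^k(\mathbb R)$ for every integer $k\ge 0$. Moreover $$\pi=\frac{\mu\psi'''-(\lambda\bar\rho+\mu|\xi|^2)\psi'}{|\xi|^{2}},\qquad (\varphi,\theta)=-\frac{(\xi_1,\xi_2)\,\psi'}{|\xi|^2}.$$ -/

import Mathlib

open Filter Topology MeasureTheory
open scoped ContDiff

/-- A steady Rayleigh-Taylor density profile on the real line: smooth, bounded below by a positive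
constant, with compactly supported derivative, and with positive derivative at some point. -/
structure IsRTProfile (ρ : ℝ → ℝ) : Prop where
  smooth : ContDiff ℝ ∞ ρ
  compactSupport_deriv : HasCompactSupport (deriv ρ)
  lower_bound : ∃ c : ℝ, 0 < c ∧ ∀ x, c ≤ ρ x
  exists_deriv_pos : ∃ x₀ : ℝ, 0 < deriv ρ x₀

/-- `h` is the weak derivative of order `n` of `f` on the real line (for locally integrable `f` and
`h`), tested against smooth compactly supported functions. -/
def HasWeakDerivOfOrder (n : ℕ) (f h : ℝ → ℝ) : Prop :=
  ∀ χ : ℝ → ℝ, ContDiff ℝ ∞ χ → HasCompactSupport χ →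
    ∫ x, f x * iteratedDeriv n χ x = (-1) ^ n * ∫ x, h x * χ x

/-- The Sobolev space `H^k` of the real line: square-integrable functions whose weak derivatives of
all orders up to `k` exist and are square-integrable. -/
def MemHk (k : ℕ) (f : ℝ → ℝ) : Prop :=
  MemLp f 2 volume ∧
    ∀ j : ℕ, j ≤ k → ∃ h : ℝ → ℝ, MemLp h 2 volume ∧ HasWeakDerivOfOrder j f h

/-- `(φ, θ, ψ, π)` is a classical solution, at horizontal frequency `ξ` and with growth rate `lam`,
of the normal-mode system of the linearized incompressible Navier-Stokes equations around the
density profile `ρ`, with viscosity `μ` and gravity `g`; the velocity components vanish at both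
infinities. -/
structure IsNormalModeSolution (ρ : ℝ → ℝ) (μ g : ℝ) (ξ : EuclideanSpace ℝ (Fin 2)) (lam : ℝ)
    (φ θ ψ π : ℝ → ℝ) : Prop where
  contDiff_φ : ContDiff ℝ 2 φ
  contDiff_θ : ContDiff ℝ 2 θ
  contDiff_ψ : ContDiff ℝ 2 ψ
  contDiff_π : ContDiff ℝ 1 π
  eq_φ : ∀ x, lam ^ 2 * ρ x * φ x - lam * ξ 0 * π x
    + lam * μ * (‖ξ‖ ^ 2 * φ x - iteratedDeriv 2 φ x) = 0
  eq_θ : ∀ x, lam ^ 2 * ρ x * θ x - lam * ξ 1 * π x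
    + lam * μ * (‖ξ‖ ^ 2 * θ x - iteratedDeriv 2 θ x) = 0
  eq_ψ : ∀ x, lam ^ 2 * ρ x * ψ x + lam * deriv π x
    + lam * μ * (‖ξ‖ ^ 2 * ψ x - iteratedDeriv 2 ψ x) = g * deriv ρ x * ψ x
  eq_div : ∀ x, ξ 0 * φ x + ξ 1 * θ x + deriv ψ x = 0
  φ_atBot : Tendsto φ atBot (𝓝 0)
  φ_atTop : Tendsto φ atTop (𝓝 0)
  θ_atBot : Tendsto θ atBot (𝓝 0)
  θ_atTop : Tendsto θ atTop (𝓝 0)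
  ψ_atBot : Tendsto ψ atBot (𝓝 0)
  ψ_atTop : Tendsto ψ atTop (𝓝 0)

/-! Fix k = |ξ| > 0. The horizontal velocity is taken parallel to ξ, so the divergence equation
gives (φ, θ) = -ξ ψ'/k², and either horizontal equation then fixes π by ψ. Substituting into the
vertical equation and multiplying by k² leaves, with d = d/dx, λμ (k² - d²)² ψ + λ² (k² ρ ψ - (ρ
ψ')') = g k² ρ' ψ.

Let u = (k² - d²) ψ, P = (k + d)⁻¹ and N = (k - d)⁻¹. These inverses are convolutions with one-sided
exponentials (`decayPast`, `decayFuture`). They are bounded on L² and adjoint to each other, and ψ =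
(P + N)u/(2k), ψ' = (N - P)u/2. Inverting one factor k² - d² turns the equation into λμ u + λ² B u =
K u, B = (NρP + PρN)/2, K = (g/4)(P + N) ρ' (P + N), with bounded symmetric operators on L². B is
nonnegative because ρ > 0. K is compact because ρ' has compact support and P + N maps bounded sets
of L² to equicontinuous families. Its form is positive somewhere because ρ' > 0 near some point.

The eigenvalue λ enters quadratically, so it is not the maximum of a Rayleigh quotient. Instead L is
the supremum of those l > 0 for which the form of lμ + l²B - K takes a negative value. At l = L the
form is nonnegative with infimum 0 on the unit sphere, and compactness of K makes it vanish at a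
unit vector (`exists_pos_quadratic_eigenvalue`).

Regularity is a bootstrap: the equation writes u through solutions of first-order linear equations,
so each round gains one derivative in L². The L² bounds then yield the Sobolev membership and the
decay at both infinities. -/

/-! ### Functions with square-integrable derivatives. -/

/-- `f` is `n` times differentiable, and `f` and its first `n` derivatives are continuous and
square-integrable. -/
def HasL2Derivs : ℕ → (ℝ → ℝ) → Prop
  | 0, f => Continuous f ∧ MemLp f 2 volume
  | n + 1, f => Differentiable ℝ f ∧ MemLp f 2 volume ∧ HasL2Derivs n (deriv f)

/-- `b` is smooth with all derivatives bounded. -/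
def HasBoundedDerivs (b : ℝ → ℝ) : Prop :=
  ContDiff ℝ ∞ b ∧ ∀ n : ℕ, ∃ C : ℝ, ∀ x, |iteratedDeriv n b x| ≤ C

theorem HasBoundedDerivs.deriv {b : ℝ → ℝ} (hb : HasBoundedDerivs b) :
    HasBoundedDerivs (deriv b) := by
  refine ⟨(contDiff_infty_iff_deriv.1 hb.1).2, fun n => ?_⟩
  obtain ⟨C, hC⟩ := hb.2 (n + 1)
  exact ⟨C, fun x => by simpa [iteratedDeriv_succ'] using hC x⟩

theorem MemLp.bdd_mul_two {b f : ℝ → ℝ} (hb : Continuous b) {C : ℝ} (hC : ∀ x, |b x| ≤ C)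
    (hf : MemLp f 2 volume) : MemLp (fun x => b x * f x) 2 volume := by
  refine MemLp.of_le_mul (c := C) hf (hb.aestronglyMeasurable.mul hf.1) ?_
  refine Eventually.of_forall fun x => ?_
  rw [norm_mul]
  exact mul_le_mul_of_nonneg_right (hC x) (norm_nonneg _)

namespace HasL2Derivs

theorem memLp {n : ℕ} {f : ℝ → ℝ} (hf : HasL2Derivs n f) : MemLp f 2 volume := by
  cases n with
  | zero => exact hf.2
  | succ n => exact hf.2.1

theorem continuous {n : ℕ} {f : ℝ → ℝ} (hf : HasL2Derivs n f) : Continuous f := by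
  cases n with
  | zero => exact hf.1
  | succ n => exact hf.1.continuous

theorem of_succ {n : ℕ} {f : ℝ → ℝ} (hf : HasL2Derivs (n + 1) f) : HasL2Derivs n f := by
  induction n generalizing f with
  | zero => exact ⟨hf.1.continuous, hf.2.1⟩
  | succ n ih => exact ⟨hf.1, hf.2.1, ih hf.2.2⟩

theorem succ_of_hasDerivAt {n : ℕ} {f f' : ℝ → ℝ} (hf : MemLp f 2 volume)
    (h : ∀ x, HasDerivAt f (f' x) x) (hf' : HasL2Derivs n f') : HasL2Derivs (n + 1) f := by
  have : deriv f = f' := funext fun x => (h x).deriv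
  exact ⟨fun x => (h x).differentiableAt, hf, this ▸ hf'⟩

theorem add {n : ℕ} {f g : ℝ → ℝ} (hf : HasL2Derivs n f) (hg : HasL2Derivs n g) :
    HasL2Derivs n (fun x => f x + g x) := by
  induction n generalizing f g with
  | zero => exact ⟨hf.1.add hg.1, hf.2.add hg.2⟩
  | succ n ih =>
    exact succ_of_hasDerivAt (hf.memLp.add hg.memLp)
      (fun x => (hf.1 x).hasDerivAt.add (hg.1 x).hasDerivAt) (ih hf.2.2 hg.2.2)

theorem const_mul {n : ℕ} {f : ℝ → ℝ} (c : ℝ) (hf : HasL2Derivs n f) :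
    HasL2Derivs n (fun x => c * f x) := by
  induction n generalizing f with
  | zero => exact ⟨hf.1.const_mul c, hf.2.const_mul c⟩
  | succ n ih =>
    exact succ_of_hasDerivAt (hf.memLp.const_mul c)
      (fun x => (hf.1 x).hasDerivAt.const_mul c) (ih hf.2.2)

theorem sub {n : ℕ} {f g : ℝ → ℝ} (hf : HasL2Derivs n f) (hg : HasL2Derivs n g) :
    HasL2Derivs n (fun x => f x - g x) := by
  have := hf.add (hg.const_mul (-1))
  simpa [sub_eq_add_neg] using this

theorem bounded_mul {n : ℕ} {b f : ℝ → ℝ} (hb : HasBoundedDerivs b) (hf : HasL2Derivs n f) :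
    HasL2Derivs n (fun x => b x * f x) := by
  obtain ⟨C, hC⟩ := hb.2 0
  have hC' : ∀ x, |b x| ≤ C := by simpa using hC
  induction n generalizing b f C with
  | zero =>
    exact ⟨hb.1.continuous.mul hf.1, MemLp.bdd_mul_two hb.1.continuous hC' hf.2⟩
  | succ n ih =>
    obtain ⟨C₁, hC₁⟩ := hb.deriv.2 0
    exact succ_of_hasDerivAt (MemLp.bdd_mul_two hb.1.continuous hC' hf.memLp)
      (fun x => ((hb.1.differentiable (by simp)) x).hasDerivAt.mul (hf.1 x).hasDerivAt)
      ((ih hb.deriv hf.of_succ C₁ hC₁ (by simpa using hC₁)).add (ih hb hf.2.2 C hC hC'))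

theorem contDiff {n : ℕ} {f : ℝ → ℝ} (hf : HasL2Derivs n f) : ContDiff ℝ n f := by
  induction n generalizing f with
  | zero => simpa [contDiff_zero] using hf.1
  | succ n ih =>
    push_cast
    refine contDiff_succ_iff_deriv.2 ⟨hf.1, by simp, ih hf.2.2⟩

theorem memLp_iteratedDeriv {n : ℕ} {f : ℝ → ℝ} (hf : HasL2Derivs n f) :
    MemLp (iteratedDeriv n f) 2 volume := by
  induction n generalizing f with
  | zero => simpa using hf.2
  | succ n ih => simpa [iteratedDeriv_succ'] using ih hf.2.2

/-- Each induction step moves one derivative by parts: it is the outermost one on the test function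
and becomes the innermost one on `f`. The compact support of the test function removes the boundary
terms. -/
theorem hasWeakDerivOfOrder {n : ℕ} {f : ℝ → ℝ} (hf : HasL2Derivs n f) :
    HasWeakDerivOfOrder n f (iteratedDeriv n f) := by
  induction n generalizing f with
  | zero => intro χ _ _; simp
  | succ n ih =>
    intro χ hχ hc
    have hsm : ContDiff ℝ ∞ (iteratedDeriv n χ) := by
      rw [iteratedDeriv_eq_iterate]
      exact hχ.iterate_deriv n
    have hcs : HasCompactSupport (iteratedDeriv n χ) := by
      have := (hc.iteratedFDeriv (𝕜 := ℝ) n)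
      exact this.comp_left (g := fun L => L fun _ => (1 : ℝ)) (by simp)
    have hibp := integral_mul_deriv_eq_deriv_mul_of_integrable
      (u := f) (v := iteratedDeriv n χ) (u' := deriv f) (v' := deriv (iteratedDeriv n χ))
      (fun x _ => (hf.1 x).hasDerivAt)
      (fun x _ => ((hsm.differentiable (by simp)) x).hasDerivAt)
      ((hf.continuous.mul (hsm.continuous_deriv (by simp))).integrable_of_hasCompactSupport
        hcs.deriv.mul_left)
      ((hf.2.2.continuous.mul hsm.continuous).integrable_of_hasCompactSupport hcs.mul_left)
      ((hf.continuous.mul hsm.continuous).integrable_of_hasCompactSupport hcs.mul_left)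
    rw [iteratedDeriv_succ, hibp, ih hf.2.2 χ hχ hc, iteratedDeriv_succ', pow_succ]
    ring

end HasL2Derivs

theorem memHk_of_hasL2Derivs {f : ℝ → ℝ} (hf : ∀ n, HasL2Derivs n f) (k : ℕ) : MemHk k f :=
  ⟨(hf 0).memLp, fun j _ =>
    ⟨iteratedDeriv j f, (hf j).memLp_iteratedDeriv, (hf j).hasWeakDerivOfOrder⟩⟩

theorem contDiff_infty_of_hasL2Derivs {f : ℝ → ℝ} (hf : ∀ n, HasL2Derivs n f) :
    ContDiff ℝ ∞ f :=
  contDiff_infty.2 fun n => (hf n).contDiff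

theorem hasL2Derivs_deriv {f : ℝ → ℝ} (hf : ∀ n, HasL2Derivs n f) (n : ℕ) :
    HasL2Derivs n (deriv f) :=
  (hf (n + 1)).2.2

theorem HasL2Derivs.integrable_sq_deriv {f : ℝ → ℝ} (hf : HasL2Derivs 1 f) :
    Integrable (fun x => f x ^ 2) ∧ Integrable (fun x => 2 * f x * deriv f x) := by
  refine ⟨hf.memLp.integrable_sq, ?_⟩
  have := (hf.memLp.integrable_mul hf.2.2.memLp).const_mul 2
  refine this.congr (Eventually.of_forall fun x => ?_)
  simp [mul_assoc]

theorem HasL2Derivs.hasDerivAt_sq {f : ℝ → ℝ} (hf : HasL2Derivs 1 f) (x : ℝ) :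
    HasDerivAt (fun x => f x ^ 2) (2 * f x * deriv f x) x := by
  simpa using (hf.1 x).hasDerivAt.fun_pow 2

theorem tendsto_zero_of_tendsto_sq {l : Filter ℝ} {f : ℝ → ℝ}
    (h : Tendsto (fun x => f x ^ 2) l (𝓝 0)) : Tendsto f l (𝓝 0) := by
  have := h.sqrt
  simp only [Real.sqrt_sq_eq_abs, Real.sqrt_zero] at this
  exact (tendsto_zero_iff_abs_tendsto_zero f).2 this

/-- Both f² and its derivative 2 f f' are integrable, hence f² tends to 0. -/
theorem HasL2Derivs.tendsto_atTop {f : ℝ → ℝ} (hf : HasL2Derivs 1 f) :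
    Tendsto f atTop (𝓝 0) :=
  tendsto_zero_of_tendsto_sq <| tendsto_zero_of_hasDerivAt_of_integrableOn_Ioi (a := 0)
    (fun x _ => hf.hasDerivAt_sq x) hf.integrable_sq_deriv.2.integrableOn
    hf.integrable_sq_deriv.1.integrableOn

theorem HasL2Derivs.tendsto_atBot {f : ℝ → ℝ} (hf : HasL2Derivs 1 f) :
    Tendsto f atBot (𝓝 0) :=
  tendsto_zero_of_tendsto_sq <| tendsto_zero_of_hasDerivAt_of_integrableOn_Iic (a := 0)
    (fun x _ => hf.hasDerivAt_sq x) hf.integrable_sq_deriv.2.integrableOn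
    hf.integrable_sq_deriv.1.integrableOn

/-! ### Cauchy-Schwarz and the one-sided exponential kernels on L². -/

theorem sq_integral_mul_le {α : Type*} [MeasurableSpace α] {ν : Measure α} {f g : α → ℝ}
    (hf : MemLp f 2 ν) (hg : MemLp g 2 ν) :
    (∫ x, f x * g x ∂ν) ^ 2 ≤ (∫ x, f x ^ 2 ∂ν) * ∫ x, g x ^ 2 ∂ν := by
  have hfg : Integrable (fun x => f x * g x) ν := hf.integrable_mul hg
  have key : ∀ t : ℝ, 0 ≤ (∫ x, g x ^ 2 ∂ν) * (t * t) + (2 * ∫ x, f x * g x ∂ν) * t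
      + ∫ x, f x ^ 2 ∂ν := fun t => by
    have h0 : 0 ≤ ∫ x, (f x + t * g x) ^ 2 ∂ν := integral_nonneg fun x => sq_nonneg _
    have h1 : ∫ x, (f x + t * g x) ^ 2 ∂ν
        = ∫ x, (f x ^ 2 + 2 * t * (f x * g x) + t * t * g x ^ 2) ∂ν :=
      integral_congr_ae (Eventually.of_forall fun x => by simp only []; ring)
    have h2 : Integrable (fun x => f x ^ 2 + 2 * t * (f x * g x)) ν :=
      hf.integrable_sq.add (hfg.const_mul _)
    rw [h1, integral_add h2 (hg.integrable_sq.const_mul _),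
      integral_add hf.integrable_sq (hfg.const_mul _), integral_const_mul, integral_const_mul] at h0
    linarith
  have := discrim_le_zero key
  rw [discrim] at this
  nlinarith

/-- The solution operator of `p' + k p = f` that decays at `-∞`. -/
noncomputable def decayPast (k : ℝ) (f : ℝ → ℝ) (x : ℝ) : ℝ :=
  ∫ y in Set.Iic x, Real.exp (-(k * (x - y))) * f y

/-- The solution operator of `-q' + k q = f` that decays at `+∞`. -/
noncomputable def decayFuture (k : ℝ) (f : ℝ → ℝ) (x : ℝ) : ℝ :=
  ∫ y in Set.Ioi x, Real.exp (-(k * (y - x))) * f y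

/-- Reflection exchanges the two operators, so only `decayPast` needs to be estimated directly. -/
theorem decayFuture_eq_decayPast (k : ℝ) (f : ℝ → ℝ) (x : ℝ) :
    decayFuture k f x = decayPast k (fun y => f (-y)) (-x) := by
  have := integral_comp_neg_Iic (-x) (fun y => Real.exp (-(k * (y - x))) * f y)
  rw [neg_neg] at this
  rw [decayFuture, ← this, decayPast]
  refine integral_congr_ae (Eventually.of_forall fun y => ?_)
  simp only []
  congr 3
  ring

theorem decayPast_eq_exp_mul (k : ℝ) (f : ℝ → ℝ) (x : ℝ) :
    decayPast k f x = Real.exp (-(k * x)) * ∫ y in Set.Iic x, Real.exp (k * y) * f y := by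
  rw [← integral_const_mul, decayPast]
  refine integral_congr_ae (Eventually.of_forall fun y => ?_)
  simp only []
  rw [← mul_assoc, ← Real.exp_add]
  congr 2
  ring

/-- The equality holds at every point, not merely almost everywhere: the operator gives a genuine
function on each L² class, from which continuous representatives are later built. -/
theorem decayPast_congr_ae {k : ℝ} {f g : ℝ → ℝ} (h : f =ᵐ[volume] g) :
    decayPast k f = decayPast k g := by
  funext x
  refine integral_congr_ae ?_
  filter_upwards [ae_restrict_of_ae h] with y hy
  rw [hy]

theorem decayFuture_congr_ae {k : ℝ} {f g : ℝ → ℝ} (h : f =ᵐ[volume] g) :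
    decayFuture k f = decayFuture k g := by
  funext x
  refine integral_congr_ae ?_
  filter_upwards [ae_restrict_of_ae h] with y hy
  rw [hy]

theorem MemLp.comp_neg_two {f : ℝ → ℝ} (hf : MemLp f 2 volume) :
    MemLp (fun y => f (-y)) 2 volume :=
  hf.comp_measurePreserving (Measure.measurePreserving_neg volume)

theorem integral_sq_comp_neg (f : ℝ → ℝ) : ∫ y, f (-y) ^ 2 = ∫ y, f y ^ 2 :=
  integral_neg_eq_self (fun y => f y ^ 2) volume

section
variable {k : ℝ} (hk : 0 < k)
include hk

theorem integrableOn_decay_kernel (x : ℝ) :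
    IntegrableOn (fun y => Real.exp (-(k * (x - y)))) (Set.Iic x) := by
  have h := (integrableOn_exp_mul_Iic hk x).const_mul (Real.exp (-(k * x)))
  refine h.congr (Eventually.of_forall fun y => ?_)
  simp only []
  rw [← Real.exp_add]
  congr 1
  ring

theorem integral_decay_kernel (x : ℝ) :
    ∫ y in Set.Iic x, Real.exp (-(k * (x - y))) = 1 / k := by
  have h : ∀ y, Real.exp (-(k * (x - y))) = Real.exp (-(k * x)) * Real.exp (k * y) := fun y => by
    rw [← Real.exp_add]
    congr 1
    ring
  simp_rw [h]
  rw [integral_const_mul, integral_exp_mul_Iic hk, ← mul_div_assoc, ← Real.exp_add]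
  simp

theorem integrableOn_decay_mul {F : ℝ → ℝ} (hF : Integrable F) (x : ℝ) :
    IntegrableOn (fun y => Real.exp (-(k * (x - y))) * F y) (Set.Iic x) := by
  refine Integrable.mono' hF.norm.integrableOn
    ((by fun_prop : Continuous fun y => Real.exp (-(k * (x - y)))).aestronglyMeasurable.mul
      hF.1.restrict) ?_
  filter_upwards [ae_restrict_mem measurableSet_Iic] with y hy
  rw [norm_mul, Real.norm_eq_abs, Real.abs_exp]
  refine mul_le_of_le_one_left (norm_nonneg _) (Real.exp_le_one_iff.2 ?_)
  have : 0 ≤ x - y := sub_nonneg.2 hy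
  have : 0 ≤ k * (x - y) := by positivity
  linarith

theorem memLp_decay_kernel (x : ℝ) :
    MemLp (fun y => Real.exp (-(k * (x - y) / 2))) 2 (volume.restrict (Set.Iic x)) := by
  rw [memLp_two_iff_integrable_sq (by fun_prop : Continuous fun y =>
    Real.exp (-(k * (x - y) / 2))).aestronglyMeasurable]
  refine (integrableOn_decay_kernel hk x).congr (Eventually.of_forall fun y => ?_)
  simp only []
  rw [← Real.exp_nat_mul]
  congr 1
  push_cast
  ring

theorem memLp_decay_kernel_mul {f : ℝ → ℝ} (hf : MemLp f 2 volume) (x : ℝ) :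
    MemLp (fun y => Real.exp (-(k * (x - y) / 2)) * f y) 2 (volume.restrict (Set.Iic x)) := by
  have hm : AEStronglyMeasurable (fun y => Real.exp (-(k * (x - y) / 2)) * f y)
      (volume.restrict (Set.Iic x)) := (by fun_prop : Continuous fun y =>
    Real.exp (-(k * (x - y) / 2))).aestronglyMeasurable.mul hf.1.restrict
  rw [memLp_two_iff_integrable_sq hm]
  refine (integrableOn_decay_mul hk hf.integrable_sq x).congr (Eventually.of_forall fun y => ?_)
  simp only []
  rw [mul_pow, ← Real.exp_nat_mul]
  congr 2
  push_cast
  ring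

theorem integrableOn_decay_mul_of_memLp {f : ℝ → ℝ} (hf : MemLp f 2 volume) (x : ℝ) :
    IntegrableOn (fun y => Real.exp (-(k * (x - y))) * f y) (Set.Iic x) := by
  refine ((memLp_decay_kernel hk x).integrable_mul (memLp_decay_kernel_mul hk hf x)).congr
    (Eventually.of_forall fun y => ?_)
  simp only [Pi.mul_apply]
  rw [← mul_assoc, ← Real.exp_add]
  congr 2
  ring

/-- Cauchy-Schwarz after splitting the kernel into two equal factors exp(-k(x - y)/2): one has
squared mass 1/k, the other stays with `f`. -/
theorem sq_decayPast_le {f : ℝ → ℝ} (hf : MemLp f 2 volume) (x : ℝ) :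
    decayPast k f x ^ 2 ≤ 1 / k * decayPast k (fun y => f y ^ 2) x := by
  have h := sq_integral_mul_le (memLp_decay_kernel hk x) (memLp_decay_kernel_mul hk hf x)
  have e1 : ∀ y, Real.exp (-(k * (x - y) / 2)) * (Real.exp (-(k * (x - y) / 2)) * f y)
      = Real.exp (-(k * (x - y))) * f y := fun y => by
    rw [← mul_assoc, ← Real.exp_add]
    congr 2
    ring
  have e2 : ∀ y, Real.exp (-(k * (x - y) / 2)) ^ 2 = Real.exp (-(k * (x - y))) := fun y => by
    rw [← Real.exp_nat_mul]
    congr 1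
    push_cast
    ring
  simp only [mul_pow, e1, e2, integral_decay_kernel hk] at h
  exact h

theorem decayPast_le_integral {F : ℝ → ℝ} (hF : Integrable F) (h0 : ∀ x, 0 ≤ F x) (x : ℝ) :
    decayPast k F x ≤ ∫ y, F y := by
  refine le_trans (setIntegral_mono_on (integrableOn_decay_mul hk hF x) hF.integrableOn
    measurableSet_Iic fun y hy => ?_) (setIntegral_le_integral hF (Eventually.of_forall h0))
  refine mul_le_of_le_one_left (h0 y) (Real.exp_le_one_iff.2 ?_)
  have : 0 ≤ x - y := sub_nonneg.2 hy
  have : 0 ≤ k * (x - y) := by positivity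
  linarith

theorem abs_decayPast_le {f : ℝ → ℝ} (hf : MemLp f 2 volume) (x : ℝ) :
    |decayPast k f x| ≤ √(1 / k) * √(∫ y, f y ^ 2) := by
  rw [← Real.sqrt_mul (by positivity), ← Real.sqrt_sq_eq_abs]
  refine Real.sqrt_le_sqrt ((sq_decayPast_le hk hf x).trans ?_)
  exact mul_le_mul_of_nonneg_left
    (decayPast_le_integral hk hf.integrable_sq (fun y => sq_nonneg _) x) (by positivity)

theorem integrable_decayPast {F : ℝ → ℝ} (hF : Integrable F) :
    Integrable (decayPast k F) ∧ ∫ x, decayPast k F x = 1 / k * ∫ x, F x := by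
  -- The operator is convolution with this kernel, whose total mass is 1/k.
  set G : ℝ → ℝ := (Set.Ici 0).indicator fun t => Real.exp (-k * t) with hG
  have hGint : Integrable G := by
    rw [hG, integrable_indicator_iff measurableSet_Ici, integrableOn_Ici_iff_integrableOn_Ioi]
    exact integrableOn_exp_mul_Ioi (by linarith) 0
  have hGval : ∫ t, G t = 1 / k := by
    rw [hG, integral_indicator measurableSet_Ici, integral_Ici_eq_integral_Ioi,
      integral_exp_mul_Ioi (by linarith)]
    simp
  have hconv : decayPast k F = convolution F G (ContinuousLinearMap.mul ℝ ℝ) volume := by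
    funext x
    rw [decayPast, ← integral_indicator measurableSet_Iic]
    refine integral_congr_ae (Eventually.of_forall fun y => ?_)
    by_cases hy : y ≤ x
    · have hy' : x - y ∈ Set.Ici (0 : ℝ) := sub_nonneg.2 hy
      simp only [hG, Set.indicator_of_mem hy', Set.indicator_of_mem (Set.mem_Iic.2 hy),
        ContinuousLinearMap.mul_apply', neg_mul]
      ring
    · simp [hG, hy]
  rw [hconv]
  refine ⟨hF.integrable_convolution _ hGint, ?_⟩
  rw [integral_convolution _ hF hGint, hGval]
  simp [mul_comm]

theorem integrableOn_exp_mul_of_memLp {f : ℝ → ℝ} (hf : MemLp f 2 volume) (x : ℝ) :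
    IntegrableOn (fun y => Real.exp (k * y) * f y) (Set.Iic x) := by
  refine ((integrableOn_decay_mul_of_memLp hk hf x).const_mul (Real.exp (k * x))).congr
    (Eventually.of_forall fun y => ?_)
  simp only []
  rw [← mul_assoc, ← Real.exp_add]
  congr 2
  ring

/-- Cutting the half-line at `y` leaves `x` only in an exponential factor and in the endpoint of an
interval integral; continuity, the derivative and the modulus of continuity are read off from this.
-/
theorem decayPast_eq_add_integral {f : ℝ → ℝ} (hf : MemLp f 2 volume) (x y : ℝ) :
    decayPast k f x = Real.exp (-(k * x)) *
      ((∫ t in Set.Iic y, Real.exp (k * t) * f t) + ∫ t in y..x, Real.exp (k * t) * f t) := by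
  rw [decayPast_eq_exp_mul, ← intervalIntegral.integral_Iic_sub_Iic
    (integrableOn_exp_mul_of_memLp hk hf y) (integrableOn_exp_mul_of_memLp hk hf x)]
  congr 1
  ring

theorem intervalIntegrable_exp_mul {f : ℝ → ℝ} (hf : MemLp f 2 volume) (x y : ℝ) :
    IntervalIntegrable (fun t => Real.exp (k * t) * f t) volume x y := by
  rw [intervalIntegrable_iff]
  exact (integrableOn_exp_mul_of_memLp hk hf (max x y)).mono_set fun t ht => ht.2

theorem continuous_decayPast {f : ℝ → ℝ} (hf : MemLp f 2 volume) :
    Continuous (decayPast k f) := by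
  rw [funext fun x => decayPast_eq_add_integral hk hf x 0]
  have := intervalIntegral.continuous_primitive (fun a b => intervalIntegrable_exp_mul hk hf a b) 0
  fun_prop

theorem hasDerivAt_decayPast {f : ℝ → ℝ} (hf : MemLp f 2 volume) (hc : Continuous f) (x : ℝ) :
    HasDerivAt (decayPast k f) (f x - k * decayPast k f x) x := by
  rw [decayPast_eq_add_integral hk hf x 0]
  rw [funext fun x => decayPast_eq_add_integral hk hf x 0]
  have h1 : HasDerivAt (fun x => ∫ t in (0 : ℝ)..x, Real.exp (k * t) * f t)
      (Real.exp (k * x) * f x) x :=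
    (by fun_prop : Continuous fun t => Real.exp (k * t) * f t).integral_hasStrictDerivAt 0 x
      |>.hasDerivAt
  have h2 : HasDerivAt (fun x => Real.exp (-(k * x))) (Real.exp (-(k * x)) * -(k * 1)) x :=
    (((hasDerivAt_id x).const_mul k).neg).exp
  refine (h2.mul (h1.const_add (∫ t in Set.Iic 0, Real.exp (k * t) * f t))).congr_deriv ?_
  rw [← mul_assoc (Real.exp (-(k * x))) (Real.exp (k * x)), ← Real.exp_add]
  simp
  ring

theorem memLp_decayPast {f : ℝ → ℝ} (hf : MemLp f 2 volume) :
    MemLp (decayPast k f) 2 volume ∧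
      ∫ x, decayPast k f x ^ 2 ≤ (1 / k) ^ 2 * ∫ x, f x ^ 2 := by
  obtain ⟨h1, h2⟩ := integrable_decayPast hk hf.integrable_sq
  have hm := (continuous_decayPast hk hf).aestronglyMeasurable (μ := volume)
  have h3 : Integrable fun x => decayPast k f x ^ 2 := by
    refine (h1.const_mul (1 / k)).mono' (hm.pow 2) (Eventually.of_forall fun x => ?_)
    rw [Real.norm_eq_abs, abs_of_nonneg (sq_nonneg _)]
    exact sq_decayPast_le hk hf x
  refine ⟨(memLp_two_iff_integrable_sq hm).2 h3, ?_⟩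
  refine (integral_mono h3 (h1.const_mul (1 / k)) fun x => sq_decayPast_le hk hf x).trans_eq ?_
  rw [integral_const_mul, h2]
  ring

/-- The increment is the damping of the old value over the time x - y plus the contribution of (y,
x]. The first is linear in x - y, the second is at most of order √(x - y) by Cauchy-Schwarz. The
bound depends on `f` only through its L² norm, which is what equicontinuity needs. -/
theorem abs_decayPast_sub_le_of_le {f : ℝ → ℝ} (hf : MemLp f 2 volume) {x y : ℝ} (hyx : y ≤ x) :
    |decayPast k f x - decayPast k f y|
      ≤ (k * (x - y) * √(1 / k) + √(x - y)) * √(∫ t, f t ^ 2) := by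
  have hxy : 0 ≤ x - y := sub_nonneg.2 hyx
  have hdec : decayPast k f x - decayPast k f y
      = -((1 - Real.exp (-(k * (x - y)))) * decayPast k f y)
        + ∫ t in y..x, Real.exp (-(k * (x - t))) * f t := by
    have h1 : ∫ t in y..x, Real.exp (-(k * (x - t))) * f t
        = Real.exp (-(k * x)) * ∫ t in y..x, Real.exp (k * t) * f t := by
      rw [← intervalIntegral.integral_const_mul]
      congr 1
      funext t
      rw [← mul_assoc, ← Real.exp_add]
      congr 2
      ring
    have h2 : Real.exp (-(k * (x - y))) * Real.exp (-(k * y)) = Real.exp (-(k * x)) := by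
      rw [← Real.exp_add]
      congr 1
      ring
    rw [decayPast_eq_add_integral hk hf x y, decayPast_eq_exp_mul k f y, h1, ← h2]
    ring
  have ha : |(1 - Real.exp (-(k * (x - y)))) * decayPast k f y|
      ≤ k * (x - y) * (√(1 / k) * √(∫ t, f t ^ 2)) := by
    rw [abs_mul]
    have e1 : |1 - Real.exp (-(k * (x - y)))| ≤ k * (x - y) := by
      have h0 : 0 ≤ k * (x - y) := by positivity
      rw [abs_of_nonneg (sub_nonneg.2 (Real.exp_le_one_iff.2 (by linarith)))]
      linarith [Real.add_one_le_exp (-(k * (x - y)))]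
    exact mul_le_mul e1 (abs_decayPast_le hk hf y) (abs_nonneg _) (by positivity)
  have hb : |∫ t in y..x, Real.exp (-(k * (x - t))) * f t| ≤ √(x - y) * √(∫ t, f t ^ 2) := by
    rw [intervalIntegral.integral_of_le hyx, ← Real.sqrt_mul hxy, ← Real.sqrt_sq_eq_abs]
    refine Real.sqrt_le_sqrt ?_
    have hm : MemLp (fun t => Real.exp (-(k * (x - t)))) 2 (volume.restrict (Set.Ioc y x)) := by
      refine MemLp.of_bound
        (by fun_prop : Continuous fun t => Real.exp (-(k * (x - t)))).aestronglyMeasurable 1 ?_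
      filter_upwards [ae_restrict_mem measurableSet_Ioc] with t ht
      rw [Real.norm_eq_abs, Real.abs_exp, Real.exp_le_one_iff]
      have : 0 ≤ k * (x - t) := mul_nonneg hk.le (sub_nonneg.2 ht.2)
      linarith
    refine (sq_integral_mul_le hm (hf.restrict _)).trans ?_
    refine mul_le_mul ?_ (setIntegral_le_integral hf.integrable_sq
      (Eventually.of_forall fun t => sq_nonneg _)) (integral_nonneg fun t => sq_nonneg _) hxy
    have h4 : ∫ t in Set.Ioc y x, (1 : ℝ) = x - y := by
      simp [hxy]
    rw [← h4]
    refine setIntegral_mono_on hm.integrable_sq (by simp) measurableSet_Ioc fun t ht => ?_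
    refine pow_le_one₀ (Real.exp_pos _).le (Real.exp_le_one_iff.2 ?_)
    have : 0 ≤ k * (x - t) := mul_nonneg hk.le (sub_nonneg.2 ht.2)
    linarith
  rw [hdec]
  refine (abs_add_le _ _).trans ?_
  rw [abs_neg]
  linarith

theorem abs_decayPast_sub_le {f : ℝ → ℝ} (hf : MemLp f 2 volume) (x y : ℝ) :
    |decayPast k f x - decayPast k f y|
      ≤ (k * |x - y| * √(1 / k) + √|x - y|) * √(∫ t, f t ^ 2) := by
  rcases le_total y x with h | h
  · rw [abs_of_nonneg (sub_nonneg.2 h)]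
    exact abs_decayPast_sub_le_of_le hk hf h
  · rw [abs_sub_comm, abs_sub_comm x y, abs_of_nonneg (sub_nonneg.2 h)]
    exact abs_decayPast_sub_le_of_le hk hf h

theorem decayPast_of_hasDerivAt {f f' : ℝ → ℝ} (h : ∀ x, HasDerivAt f (f' x) x)
    (hf : MemLp f 2 volume) (hf' : MemLp f' 2 volume) (hc : Continuous f') (x : ℝ) :
    decayPast k (fun y => f' y + k * f y) x = f x := by
  have hfc : Continuous f := continuous_iff_continuousAt.2 fun x => (h x).continuousAt
  have hm : MemLp (fun y => f' y + k * f y) 2 volume := hf'.add (hf.const_mul k)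
  -- the difference solves `w' + k w = 0` and is square integrable
  set w : ℝ → ℝ := fun x => Real.exp (k * x) * (decayPast k (fun y => f' y + k * f y) x - f x)
    with hw
  have hd : ∀ x, HasDerivAt w 0 x := fun x => by
    have h1 := (hasDerivAt_decayPast hk hm (by fun_prop) x).sub (h x)
    have h2 : HasDerivAt (fun x => Real.exp (k * x)) (Real.exp (k * x) * (k * 1)) x :=
      ((hasDerivAt_id x).const_mul k).exp
    refine (h2.mul h1).congr_deriv ?_
    simp
    ring
  have hconst : ∀ y, w y = w x := fun y =>
    is_const_of_deriv_eq_zero (fun z => (hd z).differentiableAt) (fun z => (hd z).deriv) y x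
  have hint : Integrable fun y =>
      (decayPast k (fun y => f' y + k * f y) y - f y) ^ 2 :=
    ((memLp_decayPast hk hm).1.sub hf).integrable_sq
  by_contra hne
  have hwx : w x ≠ 0 := mul_ne_zero (Real.exp_pos _).ne' (sub_ne_zero.2 hne)
  -- On the negative half-line exp(k y) ≤ 1, so the square of the nonzero constant is dominated by
  -- the square of the difference. That is integrable, while a nonzero constant is not.
  have hle : IntegrableOn (fun _ : ℝ => w x ^ 2) (Set.Iic 0) := by
    refine Integrable.mono' hint.integrableOn (by fun_prop) ?_
    filter_upwards [ae_restrict_mem measurableSet_Iic] with y hy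
    rw [Real.norm_eq_abs, abs_of_nonneg (sq_nonneg _), ← hconst y, hw]
    simp only [mul_pow]
    refine mul_le_of_le_one_left (sq_nonneg _) (pow_le_one₀ (Real.exp_pos _).le ?_)
    exact Real.exp_le_one_iff.2 (mul_nonpos_of_nonneg_of_nonpos hk.le hy)
  rw [integrableOn_const_iff (by simp)] at hle
  rcases hle with h0 | h0
  · exact hwx (by simpa using h0)
  · simp at h0

/-! ### Reflected versions -/

theorem continuous_decayFuture {f : ℝ → ℝ} (hf : MemLp f 2 volume) :
    Continuous (decayFuture k f) := by
  rw [funext fun x => decayFuture_eq_decayPast k f x]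
  exact (continuous_decayPast hk (MemLp.comp_neg_two hf)).comp continuous_neg

theorem memLp_decayFuture {f : ℝ → ℝ} (hf : MemLp f 2 volume) :
    MemLp (decayFuture k f) 2 volume ∧
      ∫ x, decayFuture k f x ^ 2 ≤ (1 / k) ^ 2 * ∫ x, f x ^ 2 := by
  obtain ⟨h1, h2⟩ := memLp_decayPast hk (MemLp.comp_neg_two hf)
  rw [funext fun x => decayFuture_eq_decayPast k f x]
  refine ⟨MemLp.comp_neg_two h1, ?_⟩
  rw [integral_sq_comp_neg (decayPast k fun y => f (-y)), ← integral_sq_comp_neg f]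
  exact h2

theorem abs_decayFuture_le {f : ℝ → ℝ} (hf : MemLp f 2 volume) (x : ℝ) :
    |decayFuture k f x| ≤ √(1 / k) * √(∫ y, f y ^ 2) := by
  rw [decayFuture_eq_decayPast, ← integral_sq_comp_neg f]
  exact abs_decayPast_le hk (MemLp.comp_neg_two hf) _

theorem abs_decayFuture_sub_le {f : ℝ → ℝ} (hf : MemLp f 2 volume) (x y : ℝ) :
    |decayFuture k f x - decayFuture k f y|
      ≤ (k * |x - y| * √(1 / k) + √|x - y|) * √(∫ t, f t ^ 2) := by
  rw [decayFuture_eq_decayPast, decayFuture_eq_decayPast, ← integral_sq_comp_neg f]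
  have := abs_decayPast_sub_le hk (MemLp.comp_neg_two hf) (-x) (-y)
  rwa [show |-x - -y| = |x - y| by rw [← abs_neg]; congr 1; ring] at this

theorem hasDerivAt_decayFuture {f : ℝ → ℝ} (hf : MemLp f 2 volume) (hc : Continuous f) (x : ℝ) :
    HasDerivAt (decayFuture k f) (k * decayFuture k f x - f x) x := by
  rw [decayFuture_eq_decayPast]
  rw [funext fun x => decayFuture_eq_decayPast k f x]
  have h := hasDerivAt_decayPast hk (MemLp.comp_neg_two hf) (hc.comp continuous_neg) (-x)
  refine (h.scomp x (hasDerivAt_neg x)).congr_deriv ?_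
  simp

theorem decayFuture_of_hasDerivAt {f f' : ℝ → ℝ} (h : ∀ x, HasDerivAt f (f' x) x)
    (hf : MemLp f 2 volume) (hf' : MemLp f' 2 volume) (hc : Continuous f') (x : ℝ) :
    decayFuture k (fun y => k * f y - f' y) x = f x := by
  have h1 : ∀ x, HasDerivAt (fun y => f (-y)) (-f' (-x)) x := fun x => by
    refine ((h (-x)).scomp x (hasDerivAt_neg x)).congr_deriv ?_
    simp
  have := decayPast_of_hasDerivAt hk h1 (MemLp.comp_neg_two hf) (MemLp.comp_neg_two hf').neg
    (by fun_prop) (-x)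
  rw [neg_neg] at this
  rw [decayFuture_eq_decayPast, ← this]
  congr 1
  funext y
  ring

theorem integral_decayPast_mul {f h : ℝ → ℝ} (hf : MemLp f 2 volume) (hh : MemLp h 2 volume) :
    ∫ x, decayPast k f x * h x = ∫ x, f x * decayFuture k h x := by
  set G : ℝ → ℝ := (Set.Ici 0).indicator fun t => Real.exp (-(k * t)) with hG
  have hGm : Measurable G := (by fun_prop : Measurable fun t => Real.exp (-(k * t))).indicator
    measurableSet_Ici
  have hG0 : ∀ t, 0 ≤ G t := fun t => Set.indicator_nonneg (fun _ _ => (Real.exp_pos _).le) t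
  have hGx : ∀ x y : ℝ, G (x - y) = (Set.Iic x).indicator (fun y => Real.exp (-(k * (x - y)))) y :=
    fun x y => by
      by_cases hy : y ≤ x <;> simp [hG, Set.indicator, hy]
  have hGy : ∀ x y : ℝ, G (x - y) = (Set.Ici y).indicator (fun x => Real.exp (-(k * (x - y)))) x :=
    fun x y => by
      by_cases hy : y ≤ x <;> simp [hG, Set.indicator, hy]
  have hsec : ∀ (e : ℝ → ℝ) (x : ℝ), (fun y => G (x - y) * e y)
      = (Set.Iic x).indicator (fun y => Real.exp (-(k * (x - y))) * e y) := fun e x => by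
    funext y
    rw [hGx, Set.indicator_mul_left]
  have hP : ∀ (e : ℝ → ℝ) (x : ℝ), ∫ y, G (x - y) * e y = decayPast k e x := fun e x => by
    rw [hsec, integral_indicator measurableSet_Iic, decayPast]
  -- Fubini applies because the inner integral of the absolute value is `decayPast` of |f| times
  -- |h|, a product of two L² functions.
  have hint : Integrable (Function.uncurry fun x y => G (x - y) * f y * h x)
      (volume.prod volume) := by
    have hmeas : AEStronglyMeasurable (Function.uncurry fun x y : ℝ => G (x - y) * f y * h x)
        (volume.prod volume) :=
      ((hGm.comp (measurable_fst.sub measurable_snd)).aestronglyMeasurable.mul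
        hf.1.comp_snd).mul hh.1.comp_fst
    rw [integrable_prod_iff hmeas]
    refine ⟨Eventually.of_forall fun x => ?_, ?_⟩
    · simp only [Function.uncurry_apply_pair]
      refine Integrable.mul_const ?_ _
      rw [hsec]
      exact (integrableOn_decay_mul_of_memLp hk hf x).integrable_indicator measurableSet_Iic
    · have e : (fun x => ∫ y, ‖Function.uncurry (fun x y => G (x - y) * f y * h x) (x, y)‖)
          = fun x => decayPast k (fun y => |f y|) x * |h x| := by
        funext x
        simp only [Function.uncurry_apply_pair, norm_mul, Real.norm_eq_abs, abs_of_nonneg (hG0 _)]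
        rw [integral_mul_const, hP (fun y => |f y|)]
      rw [e]
      exact (memLp_decayPast hk hf.abs).1.integrable_mul hh.abs
  have hswap := integral_integral_swap hint
  calc ∫ x, decayPast k f x * h x = ∫ x, ∫ y, G (x - y) * f y * h x := by
        congr 1
        funext x
        rw [integral_mul_const, hP]
    _ = ∫ y, ∫ x, G (x - y) * f y * h x := hswap
    _ = ∫ y, f y * decayFuture k h y := by
        congr 1
        funext y
        have e : ∀ x, G (x - y) * f y * h x
            = f y * (Set.Ici y).indicator (fun x => Real.exp (-(k * (x - y))) * h x) x := fun x => by
          rw [hGy, Set.indicator_mul_left]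
          ring
        simp_rw [e]
        rw [integral_const_mul, integral_indicator measurableSet_Ici, integral_Ici_eq_integral_Ioi,
          decayFuture]

end

/-! ### A quadratic eigenvalue problem in a Hilbert space. -/

section
variable {H : Type*} [NormedAddCommGroup H] [InnerProductSpace ℝ H]

/-- A nonnegative symmetric form that is small at `u` forces `Q u` to be small; this turns almost
minimizers into almost kernel vectors. -/
theorem norm_sq_le_of_nonneg_form {Q : H →L[ℝ] H}
    (hsymm : ∀ u v, inner ℝ (Q u) v = inner ℝ u (Q v)) (hpos : ∀ u, 0 ≤ inner ℝ (Q u) u) (u : H) :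
    ‖Q u‖ ^ 2 ≤ (‖Q‖ + 1) * inner ℝ (Q u) u := by
  have hM : 0 < ‖Q‖ + 1 := by positivity
  -- One gradient step of this length keeps the quadratic term below half of the linear decrease.
  -- The 1 in the denominator covers Q = 0.
  set t : ℝ := (‖Q‖ + 1)⁻¹ with ht
  have h := hpos (u - t • Q u)
  have e : inner ℝ (Q (u - t • Q u)) (u - t • Q u)
      = inner ℝ (Q u) u - 2 * t * ‖Q u‖ ^ 2 + t ^ 2 * inner ℝ (Q (Q u)) (Q u) := by
    simp only [map_sub, map_smul, inner_sub_left, inner_sub_right, real_inner_smul_left,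
      real_inner_smul_right]
    rw [hsymm (Q u) u, real_inner_self_eq_norm_sq]
    ring
  have hb : inner ℝ (Q (Q u)) (Q u) ≤ (‖Q‖ + 1) * ‖Q u‖ ^ 2 := by
    have h1 := real_inner_le_norm (Q (Q u)) (Q u)
    have h2 := Q.le_opNorm (Q u)
    nlinarith [norm_nonneg (Q u), norm_nonneg Q]
  have hb2 : t ^ 2 * inner ℝ (Q (Q u)) (Q u) ≤ t * ‖Q u‖ ^ 2 := by
    have := mul_le_mul_of_nonneg_left hb (sq_nonneg t)
    have e2 : t ^ 2 * ((‖Q‖ + 1) * ‖Q u‖ ^ 2) = t * ‖Q u‖ ^ 2 := by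
      rw [ht]; field_simp
    linarith
  have h3 : t * ‖Q u‖ ^ 2 ≤ inner ℝ (Q u) u := by linarith
  have h4 := mul_le_mul_of_nonneg_left h3 hM.le
  have e3 : (‖Q‖ + 1) * (t * ‖Q u‖ ^ 2) = ‖Q u‖ ^ 2 := by rw [ht]; field_simp
  linarith

/-- A quadratic eigenvalue problem `lam * μ * u + lam ^ 2 * B u = K u` with `B ≥ 0` and `K` compact,
symmetric and not negative semidefinite has a positive eigenvalue. -/
theorem exists_pos_quadratic_eigenvalue [CompleteSpace H] {B K : H →L[ℝ] H} {μ : ℝ} (hμ : 0 < μ)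
    (hB : ∀ u v, inner ℝ (B u) v = inner ℝ u (B v))
    (hK : ∀ u v, inner ℝ (K u) v = inner ℝ u (K v))
    (hBpos : ∀ u, 0 ≤ inner ℝ (B u) u)
    (hKpos : ∃ u, 0 < inner ℝ (K u) u)
    (hcomp : ∀ u : ℕ → H, (∀ n, ‖u n‖ ≤ 1) → ∃ φ : ℕ → ℕ, StrictMono φ ∧
      CauchySeq fun n => K (u (φ n))) :
    ∃ lam : ℝ, 0 < lam ∧ ∃ u : H, u ≠ 0 ∧ (lam * μ) • u + lam ^ 2 • B u = K u := by
  set F : ℝ → H → ℝ := fun l u => l * μ * ‖u‖ ^ 2 + l ^ 2 * inner ℝ (B u) u - inner ℝ (K u) u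
    with hF
  have hFcont : ∀ u, Continuous fun l => F l u := fun u => by simp only [hF]; fun_prop
  -- The growth rate will be the supremum of this set. It is nonempty since the form at l = 0 is
  -- that of -K, and it is bounded by ‖K‖/μ since B ≥ 0.
  set S : Set ℝ := {l | 0 < l ∧ ∃ u, F l u < 0} with hS
  have hne : ∃ l, l ∈ S := by
    obtain ⟨u, hu⟩ := hKpos
    have h0 : F 0 u < 0 := by simp [hF]; linarith
    have hev : ∀ᶠ l in 𝓝 (0 : ℝ), F l u < 0 := (hFcont u).continuousAt.eventually_lt_const h0
    have hev' : ∀ᶠ l in 𝓝[>] (0 : ℝ), F l u < 0 := hev.filter_mono nhdsWithin_le_nhds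
    obtain ⟨l, hl, hl0⟩ := (hev'.and self_mem_nhdsWithin).exists
    exact ⟨l, hl0, u, hl⟩
  have hbdd : BddAbove S := by
    refine ⟨‖K‖ / μ, ?_⟩
    rintro l ⟨hl, u, hu⟩
    rw [le_div_iff₀ hμ]
    by_contra hcon
    push Not at hcon
    have h1 := real_inner_le_norm (K u) u
    have h2 := K.le_opNorm u
    have h3 := hBpos u
    have h4 : inner ℝ (K u) u ≤ ‖K‖ * ‖u‖ ^ 2 := by nlinarith [norm_nonneg u]
    have h5 : 0 ≤ l ^ 2 * inner ℝ (B u) u := by positivity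
    have h6 : ‖K‖ * ‖u‖ ^ 2 ≤ l * μ * ‖u‖ ^ 2 := by gcongr
    simp only [hF] at hu
    linarith
  set L := sSup S with hL
  have hLpos : 0 < L := by
    obtain ⟨l, hl⟩ := hne
    exact hl.1.trans_le (le_csSup hbdd hl)
  set Q : H →L[ℝ] H := (L * μ) • ContinuousLinearMap.id ℝ H + L ^ 2 • B - K with hQ
  have hQapp : ∀ u, Q u = (L * μ) • u + L ^ 2 • B u - K u := fun u => by simp [hQ]
  have hQF : ∀ u, inner ℝ (Q u) u = F L u := fun u => by
    rw [hQapp]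
    simp only [inner_sub_left, inner_add_left, real_inner_smul_left, real_inner_self_eq_norm_sq, hF]
  have hQsymm : ∀ u v, inner ℝ (Q u) v = inner ℝ u (Q v) := fun u v => by
    rw [hQapp, hQapp]
    simp only [inner_sub_left, inner_add_left, real_inner_smul_left, inner_sub_right,
      inner_add_right, real_inner_smul_right, hB, hK]
  -- A negative value at L would persist slightly to the right of L, contradicting the supremum.
  have hQpos : ∀ u, 0 ≤ inner ℝ (Q u) u := fun u => by
    rw [hQF]
    by_contra! hneg
    have hev : ∀ᶠ l in 𝓝 L, F l u < 0 := (hFcont u).continuousAt.eventually_lt_const hneg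
    have hev' : ∀ᶠ l in 𝓝[>] L, F l u < 0 := hev.filter_mono nhdsWithin_le_nhds
    obtain ⟨l, hl, hl0⟩ := (hev'.and self_mem_nhdsWithin).exists
    have hl0 : L < l := hl0
    exact absurd (le_csSup hbdd (show l ∈ S from ⟨hLpos.trans hl0, u, hl⟩)) (not_le.2 hl0)
  -- an approximating sequence of unit vectors
  obtain ⟨l, -, hlt, hlS⟩ := exists_seq_tendsto_sSup hne hbdd
  have hunit : ∀ n, ∃ u : H, ‖u‖ = 1 ∧ F (l n) u < 0 := fun n => by
    obtain ⟨hl, u, hu⟩ := hlS n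
    have hu0 : u ≠ 0 := by
      rintro rfl
      simp [hF] at hu
    have hn : 0 < ‖u‖ := norm_pos_iff.2 hu0
    refine ⟨‖u‖⁻¹ • u, by rw [norm_smul, norm_inv, norm_norm, inv_mul_cancel₀ hn.ne'], ?_⟩
    have : F (l n) (‖u‖⁻¹ • u) = (‖u‖⁻¹) ^ 2 * F (l n) u := by
      simp only [hF, map_smul, real_inner_smul_left, real_inner_smul_right, norm_smul, norm_inv,
        norm_norm]
      ring
    rw [this]
    exact mul_neg_of_pos_of_neg (by positivity) hu
  choose u hu1 huF using hunit
  -- Since F (l n) (u n) < 0, the form at L is at most the difference of the two forms at u n, which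
  -- tends to 0 with L - l n uniformly over unit vectors.
  have hQu : Tendsto (fun n => Q (u n)) atTop (𝓝 0) := by
    have hlim : Tendsto (fun n => (‖Q‖ + 1) * (|L - l n| * μ + |L ^ 2 - l n ^ 2| * ‖B‖)) atTop
        (𝓝 0) := by
      have h1 : Tendsto (fun n => |L - l n|) atTop (𝓝 0) := by
        simpa [hL] using ((tendsto_const_nhds (x := L)).sub hlt).abs
      have h2 : Tendsto (fun n => |L ^ 2 - l n ^ 2|) atTop (𝓝 0) := by
        have h3 := ((tendsto_const_nhds (x := L ^ 2)).sub (hlt.pow 2)).abs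
        rwa [← hL, sub_self, abs_zero] at h3
      simpa using ((h1.mul_const μ).add (h2.mul_const ‖B‖)).const_mul (‖Q‖ + 1)
    have hsq : Tendsto (fun n => ‖Q (u n)‖ ^ 2) atTop (𝓝 0) := by
      refine squeeze_zero (fun n => by positivity) (fun n => ?_) hlim
      refine (norm_sq_le_of_nonneg_form hQsymm hQpos (u n)).trans ?_
      refine mul_le_mul_of_nonneg_left ?_ (by positivity)
      rw [hQF]
      have h1 : F L (u n) ≤ F L (u n) - F (l n) (u n) := by linarith [huF n]
      have h2 : F L (u n) - F (l n) (u n)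
          = (L - l n) * μ + (L ^ 2 - l n ^ 2) * inner ℝ (B (u n)) (u n) := by
        simp only [hF, hu1]; ring
      have h3 : |inner ℝ (B (u n)) (u n)| ≤ ‖B‖ := by
        have h4 := abs_real_inner_le_norm (B (u n)) (u n)
        have h5 := B.le_opNorm (u n)
        rw [hu1, mul_one] at h4 h5
        exact h4.trans h5
      have h6 : (L ^ 2 - l n ^ 2) * inner ℝ (B (u n)) (u n) ≤ |L ^ 2 - l n ^ 2| * ‖B‖ := by
        refine (le_abs_self _).trans ?_
        rw [abs_mul]
        exact mul_le_mul_of_nonneg_left h3 (abs_nonneg _)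
      have h7 : (L - l n) * μ ≤ |L - l n| * μ :=
        mul_le_mul_of_nonneg_right (le_abs_self _) hμ.le
      linarith
    rw [tendsto_zero_iff_norm_tendsto_zero]
    have := hsq.sqrt
    simpa [Real.sqrt_sq (norm_nonneg _)] using this
  obtain ⟨φ, hφ, hcau⟩ := hcomp u fun n => (hu1 n).le
  -- Q + K = Lμ + L²B is coercive. Applied to differences, this makes the subsequence Cauchy once
  -- its images under Q and K are.
  have hcoer : ∀ v, L * μ * ‖v‖ ≤ ‖Q v‖ + ‖K v‖ := fun v => by
    have h1 : L * μ * ‖v‖ ^ 2 ≤ inner ℝ (Q v + K v) v := by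
      rw [hQapp, sub_add_cancel, inner_add_left, real_inner_smul_left, real_inner_smul_left,
        real_inner_self_eq_norm_sq]
      have := hBpos v
      have : 0 ≤ L ^ 2 * inner ℝ (B v) v := by positivity
      linarith
    have h2 := real_inner_le_norm (Q v + K v) v
    have h3 := norm_add_le (Q v) (K v)
    rcases eq_or_lt_of_le (norm_nonneg v) with h0 | h0
    · rw [← h0, mul_zero]; positivity
    · have : (L * μ * ‖v‖) * ‖v‖ ≤ (‖Q v‖ + ‖K v‖) * ‖v‖ := by nlinarith
      exact le_of_mul_le_mul_right this h0
  have hQcau : CauchySeq fun n => Q (u (φ n)) :=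
    (hQu.comp hφ.tendsto_atTop).cauchySeq
  have hucau : CauchySeq fun n => u (φ n) := by
    rw [Metric.cauchySeq_iff] at hcau hQcau ⊢
    intro ε hε
    have hLμ : 0 < L * μ := by positivity
    obtain ⟨N₁, h₁⟩ := hcau (L * μ * ε / 2) (by positivity)
    obtain ⟨N₂, h₂⟩ := hQcau (L * μ * ε / 2) (by positivity)
    refine ⟨max N₁ N₂, fun m hm n hn => ?_⟩
    have a := h₁ m (le_of_max_le_left hm) n (le_of_max_le_left hn)
    have b := h₂ m (le_of_max_le_right hm) n (le_of_max_le_right hn)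
    rw [dist_eq_norm, ← map_sub] at a b
    rw [dist_eq_norm]
    have := hcoer (u (φ m) - u (φ n))
    have : L * μ * ‖u (φ m) - u (φ n)‖ < L * μ * ε := by linarith
    exact lt_of_mul_lt_mul_left this hLμ.le
  obtain ⟨w, hw⟩ := cauchySeq_tendsto_of_complete hucau
  have hw1 : ‖w‖ = 1 := by
    have := hw.norm
    simp only [hu1] at this
    exact (tendsto_nhds_unique this tendsto_const_nhds)
  have hQw : Q w = 0 :=
    tendsto_nhds_unique ((Q.continuous.tendsto w).comp hw) (hQu.comp hφ.tendsto_atTop)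
  refine ⟨L, hLpos, w, fun h => by simp [h] at hw1, ?_⟩
  rw [hQapp, sub_eq_zero] at hQw
  exact hQw

end

/-! ### Bounded operators on L² and local compactness. -/

theorem L2_inner_eq_integral (u v : Lp ℝ 2 (volume : Measure ℝ)) :
    inner ℝ u v = ∫ x, u x * v x := by
  rw [L2.inner_def]
  refine integral_congr_ae (Eventually.of_forall fun x => ?_)
  simp [mul_comm]

theorem L2_norm_sq_eq_integral (u : Lp ℝ 2 (volume : Measure ℝ)) :
    ‖u‖ ^ 2 = ∫ x, u x ^ 2 := by
  rw [← real_inner_self_eq_norm_sq, L2_inner_eq_integral]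
  simp only [sq]

theorem L2_inner_eq_of_ae {u v : Lp ℝ 2 (volume : Measure ℝ)} {f h : ℝ → ℝ}
    (hu : u =ᵐ[volume] f) (hv : v =ᵐ[volume] h) : inner ℝ u v = ∫ x, f x * h x := by
  rw [L2_inner_eq_integral]
  refine integral_congr_ae ?_
  filter_upwards [hu, hv] with x h1 h2
  rw [h1, h2]

theorem L2_norm_sq_eq_of_ae {u : Lp ℝ 2 (volume : Measure ℝ)} {f : ℝ → ℝ}
    (hu : u =ᵐ[volume] f) : ‖u‖ ^ 2 = ∫ x, f x ^ 2 := by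
  rw [← real_inner_self_eq_norm_sq, L2_inner_eq_of_ae hu hu]
  simp only [sq]

/-- A map of functions that is linear and bounded on square-integrable functions induces a bounded
operator on `L²`. -/
theorem exists_L2_operator (F : (ℝ → ℝ) → ℝ → ℝ) {C : ℝ} (hC : 0 ≤ C)
    (hmem : ∀ f, MemLp f 2 volume → MemLp (F f) 2 volume)
    (hbound : ∀ f, MemLp f 2 volume → ∫ x, F f x ^ 2 ≤ C ^ 2 * ∫ x, f x ^ 2)
    (hcongr : ∀ f h, f =ᵐ[volume] h → F f =ᵐ[volume] F h)
    (hadd : ∀ f h, MemLp f 2 volume → MemLp h 2 volume →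
      F (fun x => f x + h x) = fun x => F f x + F h x)
    (hsmul : ∀ (c : ℝ) f, F (fun x => c * f x) = fun x => c * F f x) :
    ∃ T : Lp ℝ 2 (volume : Measure ℝ) →L[ℝ] Lp ℝ 2 (volume : Measure ℝ),
      ∀ u, T u =ᵐ[volume] F u := by
  have hT : ∀ u : Lp ℝ 2 (volume : Measure ℝ),
      (hmem u (Lp.memLp u)).toLp (F u) =ᵐ[volume] F u := fun u => MemLp.coeFn_toLp _
  refine ⟨LinearMap.mkContinuous
    { toFun := fun u => (hmem u (Lp.memLp u)).toLp (F u)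
      map_add' := fun u v => ?_
      map_smul' := fun c u => ?_ } C fun u => ?_, hT⟩
  · refine Lp.ext ((hT _).trans ?_)
    refine EventuallyEq.trans ?_ (Lp.coeFn_add _ _).symm
    refine (hcongr _ _ (Lp.coeFn_add u v)).trans ?_
    have := hadd u v (Lp.memLp u) (Lp.memLp v)
    rw [show (⇑u + ⇑v) = fun x => u x + v x from rfl, this]
    exact (hT u).symm.add (hT v).symm
  · refine Lp.ext ((hT _).trans ?_)
    refine EventuallyEq.trans ?_ (Lp.coeFn_smul _ _).symm
    refine (hcongr _ _ (Lp.coeFn_smul c u)).trans ?_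
    rw [show (c • ⇑u) = fun x => c * u x from rfl, hsmul]
    filter_upwards [hT u] with x hx
    simp [hx]
  · change ‖(hmem u (Lp.memLp u)).toLp (F u)‖ ≤ C * ‖u‖
    refine abs_le_of_sq_le_sq' ?_ (by positivity) |>.2
    rw [mul_pow, L2_norm_sq_eq_of_ae (hT u), L2_norm_sq_eq_integral]
    exact hbound u (Lp.memLp u)

theorem exists_L2_mul {b : ℝ → ℝ} (hb : Continuous b) {C : ℝ} (hC : ∀ x, |b x| ≤ C) :
    ∃ T : Lp ℝ 2 (volume : Measure ℝ) →L[ℝ] Lp ℝ 2 (volume : Measure ℝ),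
      ∀ u, T u =ᵐ[volume] fun x => b x * u x := by
  refine exists_L2_operator (fun f x => b x * f x) ((abs_nonneg _).trans (hC 0))
    (fun f hf => MemLp.bdd_mul_two hb hC hf) (fun f hf => ?_) (fun f h e => ?_)
    (fun f h _ _ => by funext x; ring) (fun c f => by funext x; ring)
  · rw [← integral_const_mul]
    refine integral_mono (MemLp.bdd_mul_two hb hC hf).integrable_sq
      (hf.integrable_sq.const_mul _) fun x => ?_
    simp only [mul_pow]
    refine mul_le_mul_of_nonneg_right ?_ (sq_nonneg _)
    rw [← sq_abs]
    exact pow_le_pow_left₀ (abs_nonneg _) (hC x) 2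
  · filter_upwards [e] with x hx
    rw [hx]

section
variable {k : ℝ} (hk : 0 < k)
include hk

theorem decayPast_add {f h : ℝ → ℝ} (hf : MemLp f 2 volume) (hh : MemLp h 2 volume) :
    decayPast k (fun x => f x + h x) = fun x => decayPast k f x + decayPast k h x := by
  funext x
  simp only [decayPast]
  rw [← integral_add (integrableOn_decay_mul_of_memLp hk hf x)
    (integrableOn_decay_mul_of_memLp hk hh x)]
  simp only [mul_add]

theorem decayFuture_add {f h : ℝ → ℝ} (hf : MemLp f 2 volume) (hh : MemLp h 2 volume) :
    decayFuture k (fun x => f x + h x) = fun x => decayFuture k f x + decayFuture k h x := by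
  funext x
  simp only [decayFuture_eq_decayPast]
  exact congrFun (decayPast_add hk (MemLp.comp_neg_two hf) (MemLp.comp_neg_two hh)) (-x)

omit hk in
theorem decayPast_const_mul (c : ℝ) (f : ℝ → ℝ) :
    decayPast k (fun x => c * f x) = fun x => c * decayPast k f x := by
  funext x
  simp only [decayPast]
  rw [← integral_const_mul]
  congr 1
  funext y
  ring

omit hk in
theorem decayFuture_const_mul (c : ℝ) (f : ℝ → ℝ) :
    decayFuture k (fun x => c * f x) = fun x => c * decayFuture k f x := by
  funext x
  simp only [decayFuture_eq_decayPast]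
  exact congrFun (decayPast_const_mul c fun y => f (-y)) (-x)

theorem exists_L2_decayPast :
    ∃ T : Lp ℝ 2 (volume : Measure ℝ) →L[ℝ] Lp ℝ 2 (volume : Measure ℝ),
      ∀ u, T u =ᵐ[volume] decayPast k u :=
  exists_L2_operator (decayPast k) (C := 1 / k) (by positivity)
    (fun _ hf => (memLp_decayPast hk hf).1) (fun _ hf => (memLp_decayPast hk hf).2)
    (fun _ _ e => by rw [decayPast_congr_ae e]) (fun _ _ => decayPast_add hk)
    decayPast_const_mul

theorem exists_L2_decayFuture :
    ∃ T : Lp ℝ 2 (volume : Measure ℝ) →L[ℝ] Lp ℝ 2 (volume : Measure ℝ),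
      ∀ u, T u =ᵐ[volume] decayFuture k u :=
  exists_L2_operator (decayFuture k) (C := 1 / k) (by positivity)
    (fun _ hf => (memLp_decayFuture hk hf).1) (fun _ hf => (memLp_decayFuture hk hf).2)
    (fun _ _ e => by rw [decayFuture_congr_ae e]) (fun _ _ => decayFuture_add hk)
    decayFuture_const_mul

/-- On a compact interval the functions `decayPast k u + decayFuture k u`, with `u` in the unit ball
of `L²`, are relatively compact for uniform convergence. -/
theorem exists_subseq_uniform_cauchy (R : ℝ) (u : ℕ → ℝ → ℝ) (hu : ∀ n, MemLp (u n) 2 volume)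
    (hu1 : ∀ n, √(∫ x, u n x ^ 2) ≤ 1) :
    ∃ φ : ℕ → ℕ, StrictMono φ ∧ ∀ ε > 0, ∃ N, ∀ m ≥ N, ∀ n ≥ N, ∀ x ∈ Set.Icc (-R) R,
      |(decayPast k (u (φ m)) x + decayFuture k (u (φ m)) x)
        - (decayPast k (u (φ n)) x + decayFuture k (u (φ n)) x)| ≤ ε := by
  set w : ℕ → ℝ → ℝ := fun n x => decayPast k (u n) x + decayFuture k (u n) x with hw
  have hwc : ∀ n, Continuous (w n) := fun n =>
    (continuous_decayPast hk (hu n)).add (continuous_decayFuture hk (hu n))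
  let F : ℕ → BoundedContinuousFunction (Set.Icc (-R) R) ℝ := fun n =>
    BoundedContinuousFunction.mkOfCompact ⟨fun x => w n x, (hwc n).comp continuous_subtype_val⟩
  have hFapp : ∀ n x, F n x = w n x := fun n x => rfl
  -- Arzelà-Ascoli: the sup bound and the modulus of continuity are both uniform over the unit ball
  -- of L².
  have hcpt : IsCompact (closure (Set.range F)) := by
    refine BoundedContinuousFunction.arzela_ascoli (Metric.closedBall (0 : ℝ) (2 * √(1 / k)))
      (isCompact_closedBall _ _) _ ?_ ?_
    · rintro f x ⟨n, rfl⟩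
      rw [hFapp, mem_closedBall_zero_iff, Real.norm_eq_abs]
      refine (abs_add_le _ _).trans ?_
      have h1 := abs_decayPast_le hk (hu n) x
      have h2 := abs_decayFuture_le hk (hu n) x
      have h3 : √(1 / k) * √(∫ y, u n y ^ 2) ≤ √(1 / k) * 1 :=
        mul_le_mul_of_nonneg_left (hu1 n) (Real.sqrt_nonneg _)
      linarith
    · refine Metric.equicontinuous_of_continuity_modulus
        (fun t => 2 * (k * t * √(1 / k) + √t)) ?_ _ ?_
      · have : Continuous fun t : ℝ => 2 * (k * t * √(1 / k) + √t) := by fun_prop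
        simpa using this.tendsto 0
      · rintro x y ⟨f, n, rfl⟩
        change dist (F n x) (F n y) ≤ 2 * (k * dist x y * √(1 / k) + √(dist x y))
        rw [hFapp, hFapp, Real.dist_eq, Subtype.dist_eq, Real.dist_eq]
        have h1 := abs_decayPast_sub_le hk (hu n) x y
        have h2 := abs_decayFuture_sub_le hk (hu n) x y
        have h3 := mul_le_mul_of_nonneg_left (hu1 n)
          (show 0 ≤ k * |(x : ℝ) - y| * √(1 / k) + √|(x : ℝ) - y| by positivity)
        have h4 : w n x - w n y = (decayPast k (u n) x - decayPast k (u n) y)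
            + (decayFuture k (u n) x - decayFuture k (u n) y) := by
          simp only [hw]; ring
        rw [h4]
        refine (abs_add_le _ _).trans ?_
        linarith
  obtain ⟨a, -, φ, hφ, hlim⟩ := hcpt.tendsto_subseq fun n =>
    subset_closure (Set.mem_range_self (f := F) n)
  refine ⟨φ, hφ, fun ε hε => ?_⟩
  obtain ⟨N, hN⟩ := Metric.cauchySeq_iff.1 hlim.cauchySeq ε hε
  refine ⟨N, fun m hm n hn x hx => ?_⟩
  have h1 := (BoundedContinuousFunction.dist_coe_le_dist (f := F (φ m)) (g := F (φ n)) ⟨x, hx⟩)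
  exact h1.trans (hN m hm n hn).le

end

/-! ### The growing vertical mode of a density profile. -/

theorem IsRTProfile.hasBoundedDerivs {ρ : ℝ → ℝ} (hρ : IsRTProfile ρ) : HasBoundedDerivs ρ := by
  have hρ' : ContDiff ℝ ∞ (deriv ρ) := (contDiff_infty_iff_deriv.1 hρ.smooth).2
  refine ⟨hρ.smooth, fun n => ?_⟩
  cases n with
  | zero =>
    -- ρ itself need not have compact support; it is bounded because its derivative is integrable.
    have hint : Integrable (deriv ρ) :=
      hρ'.continuous.integrable_of_hasCompactSupport hρ.compactSupport_deriv
    refine ⟨|ρ 0| + ∫ x, ‖deriv ρ x‖, fun x => ?_⟩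
    have h1 : ∫ t in (0 : ℝ)..x, deriv ρ t = ρ x - ρ 0 :=
      intervalIntegral.integral_eq_sub_of_hasDerivAt
        (fun t _ => (hρ.smooth.differentiable (by simp) t).hasDerivAt)
        (hρ'.continuous.intervalIntegrable _ _)
    have h2 : |∫ t in (0 : ℝ)..x, deriv ρ t| ≤ ∫ x, ‖deriv ρ x‖ :=
      (intervalIntegral.norm_integral_le_integral_norm_uIoc).trans
        (setIntegral_le_integral hint.norm (Eventually.of_forall fun t => norm_nonneg _))
    rw [h1] at h2
    have h3 := abs_add_le (ρ 0) (ρ x - ρ 0)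
    rw [add_sub_cancel] at h3
    simp only [iteratedDeriv_zero]
    linarith
  | succ n =>
    have hc : HasCompactSupport (iteratedDeriv n (deriv ρ)) := by
      have := (hρ.compactSupport_deriv.iteratedFDeriv (𝕜 := ℝ) n)
      exact this.comp_left (g := fun L => L fun _ => (1 : ℝ)) (by simp)
    obtain ⟨C, hC⟩ := hc.exists_bound_of_continuous
      (hρ'.continuous_iteratedDeriv n (mod_cast le_top))
    exact ⟨C, fun x => by simpa [iteratedDeriv_succ'] using hC x⟩

theorem IsRTProfile.pos {ρ : ℝ → ℝ} (hρ : IsRTProfile ρ) (x : ℝ) : 0 < ρ x := by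
  obtain ⟨c, hc, h⟩ := hρ.lower_bound
  exact hc.trans_le (h x)

/-- A test function on which the destabilizing form is positive. -/
theorem IsRTProfile.exists_pos_form {ρ : ℝ → ℝ} (hρ : IsRTProfile ρ) {k : ℝ} (hk : 0 < k) :
    ∃ f : ℝ → ℝ, MemLp f 2 volume ∧
      0 < ∫ x, deriv ρ x * (decayPast k f x + decayFuture k f x) ^ 2 := by
  obtain ⟨x₀, hx₀⟩ := hρ.exists_deriv_pos
  have hρ' : Continuous (deriv ρ) := hρ.hasBoundedDerivs.deriv.1.continuous
  obtain ⟨r, hr, hball⟩ := Metric.isOpen_iff.1 (isOpen_lt continuous_const hρ') x₀ hx₀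
  let B : ContDiffBump x₀ := ⟨r / 2, r, by positivity, by linarith⟩
  set b : ℝ → ℝ := fun x => B x with hb
  have hbs : ContDiff ℝ ∞ b := B.contDiff
  have hbc : HasCompactSupport b := B.hasCompactSupport
  have hb1s : ContDiff ℝ ∞ (deriv b) := (contDiff_infty_iff_deriv.1 hbs).2
  have hb2s : ContDiff ℝ ∞ (deriv (deriv b)) := (contDiff_infty_iff_deriv.1 hb1s).2
  have m0 : MemLp b 2 volume := hbs.continuous.memLp_of_hasCompactSupport hbc
  have m1 : MemLp (deriv b) 2 volume := hb1s.continuous.memLp_of_hasCompactSupport hbc.deriv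
  have m2 : MemLp (deriv (deriv b)) 2 volume :=
    hb2s.continuous.memLp_of_hasCompactSupport hbc.deriv.deriv
  have d0 : ∀ x, HasDerivAt b (deriv b x) x := fun x =>
    (hbs.differentiable (by simp) x).hasDerivAt
  have d1 : ∀ x, HasDerivAt (deriv b) (deriv (deriv b) x) x := fun x =>
    (hb1s.differentiable (by simp) x).hasDerivAt
  have c1 := hb1s.continuous
  have c2 := hb2s.continuous
  -- With b a bump supported where ρ' > 0, take f = (k² - d²) b. Factoring k² - d² as (k + d)(k - d)
  -- in either order, the two operators return k b - b' and k b + b', with sum 2 k b.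
  refine ⟨fun x => k ^ 2 * b x - deriv (deriv b) x, (m0.const_mul _).sub m2, ?_⟩
  have hP : ∀ x, decayPast k (fun x => k ^ 2 * b x - deriv (deriv b) x) x
      = k * b x - deriv b x := fun x => by
    rw [← decayPast_of_hasDerivAt hk (f := fun x => k * b x - deriv b x)
      (fun x => ((d0 x).const_mul k).sub (d1 x)) ((m0.const_mul _).sub m1)
      ((m1.const_mul _).sub m2) (by fun_prop) x]
    congr 1
    funext y
    ring
  have hN : ∀ x, decayFuture k (fun x => k ^ 2 * b x - deriv (deriv b) x) x
      = k * b x + deriv b x := fun x => by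
    rw [← decayFuture_of_hasDerivAt hk (f := fun x => k * b x + deriv b x)
      (fun x => ((d0 x).const_mul k).add (d1 x)) ((m0.const_mul _).add m1)
      ((m1.const_mul _).add m2) (by fun_prop) x]
    congr 1
    funext y
    ring
  have e : ∀ x, deriv ρ x * (decayPast k (fun x => k ^ 2 * b x - deriv (deriv b) x) x
      + decayFuture k (fun x => k ^ 2 * b x - deriv (deriv b) x) x) ^ 2
      = 4 * k ^ 2 * (deriv ρ x * b x ^ 2) := fun x => by
    rw [hP, hN]
    ring
  simp_rw [e]
  rw [integral_const_mul]
  refine mul_pos (by positivity) ?_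
  refine Continuous.integral_pos_of_hasCompactSupport_nonneg_nonzero (x := x₀)
    (hρ'.mul (hbs.continuous.pow 2)) ?_ ?_ ?_
  · exact hρ.compactSupport_deriv.mul_right
  · intro x
    by_cases hx : x ∈ Metric.ball x₀ r
    · have : 0 < deriv ρ x := hball hx
      exact mul_nonneg this.le (sq_nonneg _)
    · have : b x = 0 := by
        have : x ∉ Function.support B := by rwa [B.support_eq]
        exact Function.notMem_support.1 this
      simp [this]
  · have : b x₀ = 1 := B.one_of_mem_closedBall (by simp [B]; positivity)
    simp [this, hx₀.ne']

/-- The variational eigenvalue problem for the growth rate, written for `u = k² ψ - ψ''`. -/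
theorem IsRTProfile.exists_growth_mode {ρ : ℝ → ℝ} (hρ : IsRTProfile ρ) {μ g k : ℝ} (hμ : 0 < μ)
    (hg : 0 < g) (hk : 0 < k) :
    ∃ lam : ℝ, 0 < lam ∧ ∃ u : ℝ → ℝ, Continuous u ∧ MemLp u 2 volume ∧ (∃ x, u x ≠ 0) ∧
      ∀ x, lam * μ * u x
        + lam ^ 2 / 2 * (decayFuture k (fun y => ρ y * decayPast k u y) x
          + decayPast k (fun y => ρ y * decayFuture k u y) x)
        = g / 4 * (decayPast k (fun y => deriv ρ y * (decayPast k u y + decayFuture k u y)) x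
          + decayFuture k (fun y => deriv ρ y * (decayPast k u y + decayFuture k u y)) x) := by
  have hbd := hρ.hasBoundedDerivs
  have hρc := hbd.1.continuous
  have hρ'c := hbd.deriv.1.continuous
  obtain ⟨C₀, hC₀⟩ := hbd.2 0
  obtain ⟨C₁, hC₁⟩ := hbd.deriv.2 0
  simp only [iteratedDeriv_zero] at hC₀ hC₁
  obtain ⟨P, hP⟩ := exists_L2_decayPast hk
  obtain ⟨N, hN⟩ := exists_L2_decayFuture hk
  obtain ⟨M, hM⟩ := exists_L2_mul hρc hC₀
  obtain ⟨D, hD⟩ := exists_L2_mul hρ'c hC₁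
  have hadj : ∀ u v, inner ℝ (P u) v = inner ℝ u (N v) := fun u v => by
    rw [L2_inner_eq_of_ae (hP u) (ae_eq_refl v), L2_inner_eq_of_ae (ae_eq_refl u) (hN v)]
    exact integral_decayPast_mul hk (Lp.memLp u) (Lp.memLp v)
  have hadj' : ∀ u v, inner ℝ (N u) v = inner ℝ u (P v) := fun u v => by
    rw [real_inner_comm, ← hadj, real_inner_comm]
  have hMs : ∀ u v, inner ℝ (M u) v = inner ℝ u (M v) := fun u v => by
    rw [L2_inner_eq_of_ae (hM u) (ae_eq_refl v), L2_inner_eq_of_ae (ae_eq_refl u) (hM v)]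
    congr 1
    funext x
    ring
  have hDs : ∀ u v, inner ℝ (D u) v = inner ℝ u (D v) := fun u v => by
    rw [L2_inner_eq_of_ae (hD u) (ae_eq_refl v), L2_inner_eq_of_ae (ae_eq_refl u) (hD v)]
    congr 1
    funext x
    ring
  have hMpos : ∀ u, 0 ≤ inner ℝ (M u) u := fun u => by
    rw [L2_inner_eq_of_ae (hM u) (ae_eq_refl u)]
    refine integral_nonneg fun x => ?_
    have := mul_nonneg (hρ.pos x).le (mul_self_nonneg (u x))
    simpa [mul_assoc] using this
  have hsum : ∀ u, (P + N) u =ᵐ[volume] fun x => decayPast k u x + decayFuture k u x :=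
    fun u => (Lp.coeFn_add _ _).trans ((hP u).add (hN u))
  -- The form of B is ∫ ρ (k² ψ² + ψ'²). With k ψ = (p + q)/2 and ψ' = (q - p)/2, for p = P u and q
  -- = N u, the cross terms cancel and ∫ ρ (p² + q²)/2 remains.
  set B := (1 / 2 : ℝ) • (N ∘L M ∘L P + P ∘L M ∘L N) with hB
  set K := (g / 4) • ((P + N) ∘L D ∘L (P + N)) with hK
  have hBapp : ∀ u, B u = (1 / 2 : ℝ) • (N (M (P u)) + P (M (N u))) := fun u => by simp [hB]
  have hKapp : ∀ u, K u = (g / 4) • (P + N) (D ((P + N) u)) := fun u => by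
    simp only [hK, smul_apply, ContinuousLinearMap.comp_apply]
  have hSs : ∀ u v, inner ℝ ((P + N) u) v = inner ℝ u ((P + N) v) := fun u v => by
    simp only [add_apply, inner_add_left, inner_add_right, hadj, hadj']
    ring
  have hKcomp : ∀ u : ℕ → Lp ℝ 2 (volume : Measure ℝ), (∀ n, ‖u n‖ ≤ 1) →
      ∃ φ : ℕ → ℕ, StrictMono φ ∧ CauchySeq fun n => K (u (φ n)) := fun u hu => by
    -- ρ' vanishes off [-R, R], so uniform closeness of the functions (P + N)u there gives L²
    -- closeness after multiplication by ρ'.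
    obtain ⟨R, hR⟩ := hρ.compactSupport_deriv.isCompact.isBounded.subset_closedBall 0
    obtain ⟨φ, hφ, hcau⟩ := exists_subseq_uniform_cauchy hk R (fun n => u n)
      (fun n => Lp.memLp (u n)) fun n => by
        rw [← L2_norm_sq_eq_integral, Real.sqrt_sq (norm_nonneg _)]
        exact hu n
    refine ⟨φ, hφ, Metric.cauchySeq_iff.2 fun ε hε => ?_⟩
    have hρ'2 : Integrable fun x => deriv ρ x ^ 2 :=
      (hρ'c.memLp_of_hasCompactSupport hρ.compactSupport_deriv).integrable_sq
    -- The added 1 makes c positive, so that ε/(2c) makes sense even if the operator norm vanishes.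
    set c : ℝ := g / 4 * (‖P + N‖ * √(∫ x, deriv ρ x ^ 2)) + 1 with hc
    have hcpos : 0 < c := by positivity
    obtain ⟨n₀, hn₀⟩ := hcau (ε / (2 * c)) (by positivity)
    refine ⟨n₀, fun m hm n hn => ?_⟩
    have hδ := hn₀ m hm n hn
    set δ : ℝ := ε / (2 * c) with hδdef
    have hδ0 : 0 ≤ δ := by positivity
    set v := u (φ m) - u (φ n) with hv
    have hDv : D ((P + N) v) =ᵐ[volume] fun x => deriv ρ x *
        ((decayPast k (u (φ m)) x + decayFuture k (u (φ m)) x)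
          - (decayPast k (u (φ n)) x + decayFuture k (u (φ n)) x)) := by
      rw [hv, map_sub]
      filter_upwards [hD ((P + N) (u (φ m)) - (P + N) (u (φ n))), hsum (u (φ m)), hsum (u (φ n)),
        Lp.coeFn_sub ((P + N) (u (φ m))) ((P + N) (u (φ n)))] with x h1 h2 h3 h4
      rw [h1, h4, Pi.sub_apply, h2, h3]
    have hnorm : ‖D ((P + N) v)‖ ≤ δ * √(∫ x, deriv ρ x ^ 2) := by
      refine abs_le_of_sq_le_sq' ?_ (by positivity) |>.2
      rw [L2_norm_sq_eq_of_ae hDv, mul_pow,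
        Real.sq_sqrt (integral_nonneg fun x => sq_nonneg _), ← integral_const_mul]
      refine integral_mono_of_nonneg (Eventually.of_forall fun x => sq_nonneg _)
        (hρ'2.const_mul _) (Eventually.of_forall fun x => ?_)
      simp only [mul_pow]
      rw [mul_comm]
      by_cases hx : x ∈ Set.Icc (-R) R
      · refine mul_le_mul_of_nonneg_right ?_ (sq_nonneg _)
        rw [← sq_abs]
        exact pow_le_pow_left₀ (abs_nonneg _) (hδ x hx) 2
      · have : deriv ρ x = 0 := by
          by_contra hne
          refine hx ?_
          have := hR (subset_tsupport _ hne)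
          rwa [Real.closedBall_eq_Icc, zero_sub, zero_add] at this
        simp [this]
    rw [dist_eq_norm, ← map_sub, ← hv, hKapp, norm_smul, Real.norm_eq_abs,
      abs_of_pos (by positivity : 0 < g / 4)]
    have h1 := (P + N).le_opNorm (D ((P + N) v))
    have h2 : ‖P + N‖ * ‖D ((P + N) v)‖ ≤ ‖P + N‖ * (δ * √(∫ x, deriv ρ x ^ 2)) :=
      mul_le_mul_of_nonneg_left hnorm (norm_nonneg _)
    have h3 : g / 4 * ‖(P + N) (D ((P + N) v))‖
        ≤ g / 4 * (‖P + N‖ * (δ * √(∫ x, deriv ρ x ^ 2))) :=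
      mul_le_mul_of_nonneg_left (h1.trans h2) (by positivity)
    have h4 : g / 4 * (‖P + N‖ * (δ * √(∫ x, deriv ρ x ^ 2))) = δ * (c - 1) := by
      rw [hc]; ring
    have h5 : δ * c = ε / 2 := by rw [hδdef]; field_simp
    have h6 : δ * (c - 1) ≤ δ * c := mul_le_mul_of_nonneg_left (by linarith) hδ0
    linarith
  have hKpos : ∃ u, 0 < inner ℝ (K u) u := by
    obtain ⟨f, hf, hpos⟩ := hρ.exists_pos_form hk
    refine ⟨hf.toLp f, ?_⟩
    have hSf : (P + N) (hf.toLp f) =ᵐ[volume] fun x => decayPast k f x + decayFuture k f x := by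
      refine (hsum _).trans ?_
      rw [decayPast_congr_ae hf.coeFn_toLp, decayFuture_congr_ae hf.coeFn_toLp]
    have hDSf : D ((P + N) (hf.toLp f)) =ᵐ[volume]
        fun x => deriv ρ x * (decayPast k f x + decayFuture k f x) := by
      filter_upwards [hD ((P + N) (hf.toLp f)), hSf] with x h1 h2
      rw [h1, h2]
    rw [hKapp, real_inner_smul_left, hSs, L2_inner_eq_of_ae hDSf hSf]
    refine mul_pos (by positivity) ?_
    simpa only [mul_assoc, sq] using hpos
  obtain ⟨lam, hlam, u, hu0, hu⟩ := exists_pos_quadratic_eigenvalue (B := B) (K := K) hμ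
    (fun u v => by
      simp only [hBapp, real_inner_smul_left, real_inner_smul_right, inner_add_left,
        inner_add_right, hadj, hadj', hMs])
    (fun u v => by
      rw [hKapp, hKapp, real_inner_smul_left, real_inner_smul_right, hSs, hDs, hSs])
    (fun u => by
      rw [hBapp, real_inner_smul_left, inner_add_left, hadj', hadj]
      have h1 := hMpos (P u)
      have h2 := hMpos (N u)
      positivity)
    hKpos hKcomp
  refine ⟨lam, hlam, ?_⟩
  -- the continuous representative
  have hp := memLp_decayPast hk (Lp.memLp u)
  have hq := memLp_decayFuture hk (Lp.memLp u)
  have mr : MemLp (fun y => ρ y * decayPast k u y) 2 volume := MemLp.bdd_mul_two hρc hC₀ hp.1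
  have ms : MemLp (fun y => ρ y * decayFuture k u y) 2 volume := MemLp.bdd_mul_two hρc hC₀ hq.1
  have ma : MemLp (fun y => deriv ρ y * (decayPast k u y + decayFuture k u y)) 2 volume :=
    MemLp.bdd_mul_two hρ'c hC₁ (hp.1.add hq.1)
  set w : ℝ → ℝ := fun x => (lam * μ)⁻¹ *
    (g / 4 * (decayPast k (fun y => deriv ρ y * (decayPast k u y + decayFuture k u y)) x
          + decayFuture k (fun y => deriv ρ y * (decayPast k u y + decayFuture k u y)) x)
      - lam ^ 2 / 2 * (decayFuture k (fun y => ρ y * decayPast k u y) x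
          + decayPast k (fun y => ρ y * decayFuture k u y) x)) with hw
  have hwc : Continuous w := by
    have c1 := continuous_decayPast hk ma
    have c2 := continuous_decayFuture hk ma
    have c3 := continuous_decayFuture hk mr
    have c4 := continuous_decayPast hk ms
    fun_prop
  have huw : u =ᵐ[volume] w := by
    have e1 : N (M (P u)) =ᵐ[volume] decayFuture k (fun y => ρ y * decayPast k u y) := by
      refine (hN _).trans ?_
      rw [decayFuture_congr_ae ((hM (P u)).trans ?_)]
      filter_upwards [hP u] with x hx
      rw [hx]
    have e2 : P (M (N u)) =ᵐ[volume] decayPast k (fun y => ρ y * decayFuture k u y) := by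
      refine (hP _).trans ?_
      rw [decayPast_congr_ae ((hM (N u)).trans ?_)]
      filter_upwards [hN u] with x hx
      rw [hx]
    have e3 : D ((P + N) u) =ᵐ[volume]
        fun y => deriv ρ y * (decayPast k u y + decayFuture k u y) := by
      filter_upwards [hD ((P + N) u), hsum u] with x h1 h2
      rw [h1, h2]
    have e4 := hsum (D ((P + N) u))
    rw [decayPast_congr_ae e3, decayFuture_congr_ae e3] at e4
    rw [hBapp, hKapp] at hu
    filter_upwards [e1, e2, e4, Lp.coeFn_smul (g / 4) ((P + N) (D ((P + N) u))),
      Lp.coeFn_add ((lam * μ) • u) (lam ^ 2 • (1 / 2 : ℝ) • (N (M (P u)) + P (M (N u)))),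
      Lp.coeFn_smul (lam * μ) u,
      Lp.coeFn_smul (lam ^ 2) ((1 / 2 : ℝ) • (N (M (P u)) + P (M (N u)))),
      Lp.coeFn_smul (1 / 2 : ℝ) (N (M (P u)) + P (M (N u))),
      Lp.coeFn_add (N (M (P u))) (P (M (N u)))] with x h1 h2 h3 h4 h5 h6 h7 h8 h9
    rw [hu, h4, Pi.add_apply, h6, h7, Pi.smul_apply, Pi.smul_apply, Pi.smul_apply, h8,
      Pi.smul_apply, h9, Pi.add_apply, h1, h2, h3] at h5
    simp only [smul_eq_mul] at h5
    rw [hw, eq_inv_mul_iff_mul_eq₀ (by positivity), h5]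
    ring
  have hPw : decayPast k w = decayPast k u := decayPast_congr_ae huw.symm
  have hNw : decayFuture k w = decayFuture k u := decayFuture_congr_ae huw.symm
  refine ⟨w, hwc, (memLp_congr_ae huw).1 (Lp.memLp u), ?_, fun x => ?_⟩
  · by_contra! h0
    refine hu0 (Lp.ext (huw.trans ?_))
    filter_upwards [Lp.coeFn_zero ℝ 2 (volume : Measure ℝ)] with x hx
    rw [hx, h0 x, Pi.zero_apply]
  · rw [hPw, hNw]
    simp only [hw]
    rw [mul_inv_cancel_left₀ (by positivity)]
    ring

/-- The growing mode in the vertical variable, at horizontal wave number `k`. -/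
theorem IsRTProfile.exists_vertical_mode {ρ : ℝ → ℝ} (hρ : IsRTProfile ρ) {μ g k : ℝ} (hμ : 0 < μ)
    (hg : 0 < g) (hk : 0 < k) :
    ∃ lam : ℝ, 0 < lam ∧ ∃ ψ π : ℝ → ℝ, (∃ x, ψ x ≠ 0) ∧
      (∀ n, HasL2Derivs n ψ) ∧ (∀ n, HasL2Derivs n π) ∧
      (∀ x, π x = (μ * iteratedDeriv 3 ψ x - (lam * ρ x + μ * k ^ 2) * deriv ψ x) / k ^ 2) ∧
      (∀ x, lam ^ 2 * ρ x * ψ x + lam * deriv π x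
        + lam * μ * (k ^ 2 * ψ x - iteratedDeriv 2 ψ x) = g * deriv ρ x * ψ x) := by
  obtain ⟨lam, hlam, u, huc, hum, ⟨x₁, hx₁⟩, hu⟩ := hρ.exists_growth_mode hμ hg hk
  have hbd := hρ.hasBoundedDerivs
  have hbd' := hbd.deriv
  set p := decayPast k u with hp
  set q := decayFuture k u with hq
  have p0 : HasL2Derivs 0 p := ⟨continuous_decayPast hk hum, (memLp_decayPast hk hum).1⟩
  have q0 : HasL2Derivs 0 q := ⟨continuous_decayFuture hk hum, (memLp_decayFuture hk hum).1⟩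
  have fr := HasL2Derivs.bounded_mul hbd p0
  have fs := HasL2Derivs.bounded_mul hbd q0
  have fa := HasL2Derivs.bounded_mul hbd' (p0.add q0)
  set r := decayFuture k (fun y => ρ y * p y) with hr
  set s := decayPast k (fun y => ρ y * q y) with hs
  set a := decayPast k (fun y => deriv ρ y * (p y + q y)) with ha
  set b := decayFuture k (fun y => deriv ρ y * (p y + q y)) with hb
  have dp : ∀ x, HasDerivAt p (u x - k * p x) x := hasDerivAt_decayPast hk hum huc
  have dq : ∀ x, HasDerivAt q (k * q x - u x) x := hasDerivAt_decayFuture hk hum huc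
  have dr : ∀ x, HasDerivAt r (k * r x - ρ x * p x) x := hasDerivAt_decayFuture hk fr.2 fr.1
  have ds : ∀ x, HasDerivAt s (ρ x * q x - k * s x) x := hasDerivAt_decayPast hk fs.2 fs.1
  have da : ∀ x, HasDerivAt a (deriv ρ x * (p x + q x) - k * a x) x :=
    hasDerivAt_decayPast hk fa.2 fa.1
  have db : ∀ x, HasDerivAt b (k * b x - deriv ρ x * (p x + q x)) x :=
    hasDerivAt_decayFuture hk fa.2 fa.1
  have hu' : u = fun x => (lam * μ)⁻¹ * (g / 4 * (a x + b x) - lam ^ 2 / 2 * (r x + s x)) := by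
    funext x
    rw [eq_inv_mul_iff_mul_eq₀ (by positivity)]
    linarith [hu x]
  -- bootstrap
  have hall : ∀ n, HasL2Derivs n p ∧ HasL2Derivs n q ∧ HasL2Derivs n r ∧ HasL2Derivs n s ∧
      HasL2Derivs n a ∧ HasL2Derivs n b := by
    intro n
    induction n with
    | zero =>
      exact ⟨p0, q0, ⟨continuous_decayFuture hk fr.2, (memLp_decayFuture hk fr.2).1⟩,
        ⟨continuous_decayPast hk fs.2, (memLp_decayPast hk fs.2).1⟩,
        ⟨continuous_decayPast hk fa.2, (memLp_decayPast hk fa.2).1⟩,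
        ⟨continuous_decayFuture hk fa.2, (memLp_decayFuture hk fa.2).1⟩⟩
    | succ n ih =>
      obtain ⟨ip, iq, ir, is, ia, ib⟩ := ih
      have iu : HasL2Derivs n u := by
        rw [hu']
        exact (((ia.add ib).const_mul _).sub ((ir.add is).const_mul _)).const_mul _
      have iρ := HasL2Derivs.bounded_mul hbd' (ip.add iq)
      exact ⟨.succ_of_hasDerivAt ip.memLp dp (iu.sub (ip.const_mul k)),
        .succ_of_hasDerivAt iq.memLp dq ((iq.const_mul k).sub iu),
        .succ_of_hasDerivAt ir.memLp dr ((ir.const_mul k).sub (HasL2Derivs.bounded_mul hbd ip)),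
        .succ_of_hasDerivAt is.memLp ds ((HasL2Derivs.bounded_mul hbd iq).sub (is.const_mul k)),
        .succ_of_hasDerivAt ia.memLp da (iρ.sub (ia.const_mul k)),
        .succ_of_hasDerivAt ib.memLp db ((ib.const_mul k).sub iρ)⟩
  -- By partial fractions, (k² - d²)⁻¹ = ((k + d)⁻¹ + (k - d)⁻¹)/(2k).
  set ψ : ℝ → ℝ := fun x => 1 / (2 * k) * (p x + q x) with hψ
  -- The vertical equation prescribes π'. Since (r - s)' = k(r + s) - ρ(p + q) and (b - a)' = k(a +
  -- b) - 2ρ'(p + q), this combination is an antiderivative of it that visibly lies in L².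
  set π : ℝ → ℝ := fun x => 1 / k * (lam / 2 * (r x - s x) - g / (4 * lam) * (b x - a x)) with hπ
  have d1 : ∀ x, HasDerivAt ψ (1 / 2 * (q x - p x)) x := fun x => by
    refine (((dp x).add (dq x)).const_mul _).congr_deriv ?_
    field_simp
    ring
  have d2 : ∀ x, HasDerivAt (fun x => 1 / 2 * (q x - p x)) (k ^ 2 * ψ x - u x) x := fun x => by
    refine (((dq x).sub (dp x)).const_mul _).congr_deriv ?_
    simp only [hψ]
    field_simp
    ring
  have du : ∀ x, HasDerivAt u ((lam * μ)⁻¹ * (g / 4 * (k * (b x - a x))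
      - lam ^ 2 / 2 * (k * (r x - s x) + ρ x * (q x - p x)))) x := fun x => by
    conv => enter [1]; rw [hu']
    refine (((((da x).add (db x)).const_mul _).sub
      (((dr x).add (ds x)).const_mul _)).const_mul _).congr_deriv ?_
    ring
  have d3 : ∀ x, HasDerivAt (fun x => k ^ 2 * ψ x - u x) (k ^ 2 * (1 / 2 * (q x - p x))
      - (lam * μ)⁻¹ * (g / 4 * (k * (b x - a x))
        - lam ^ 2 / 2 * (k * (r x - s x) + ρ x * (q x - p x)))) x := fun x =>
    ((d1 x).const_mul _).sub (du x)
  have dπ : ∀ x, HasDerivAt π (1 / k * (lam / 2 * ((k * r x - ρ x * p x) - (ρ x * q x - k * s x))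
      - g / (4 * lam) * ((k * b x - deriv ρ x * (p x + q x))
        - (deriv ρ x * (p x + q x) - k * a x)))) x := fun x =>
    ((((dr x).sub (ds x)).const_mul _).sub (((db x).sub (da x)).const_mul _)).const_mul _
  have i1 : deriv ψ = fun x => 1 / 2 * (q x - p x) := funext fun x => (d1 x).deriv
  have i2 : iteratedDeriv 2 ψ = fun x => k ^ 2 * ψ x - u x := by
    rw [iteratedDeriv_succ, iteratedDeriv_one, i1]
    exact funext fun x => (d2 x).deriv
  have i3 : ∀ x, iteratedDeriv 3 ψ x = k ^ 2 * (1 / 2 * (q x - p x))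
      - (lam * μ)⁻¹ * (g / 4 * (k * (b x - a x))
        - lam ^ 2 / 2 * (k * (r x - s x) + ρ x * (q x - p x))) := fun x => by
    rw [iteratedDeriv_succ, i2]
    exact (d3 x).deriv
  refine ⟨lam, hlam, ψ, π, ?_, fun n => ?_, fun n => ?_, fun x => ?_, fun x => ?_⟩
  -- If ψ vanished, so would u = k² ψ - ψ'', contrary to u x₁ ≠ 0.
  · by_contra! h0
    have hψ0 : ψ = fun _ => 0 := funext h0
    have h2 : iteratedDeriv 2 ψ x₁ = 0 := by
      rw [hψ0]
      simp
    rw [i2] at h2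
    simp only [h0 x₁] at h2
    exact hx₁ (by linarith)
  · exact ((hall n).1.add (hall n).2.1).const_mul _
  · obtain ⟨-, -, ir, is, ia, ib⟩ := hall n
    exact (((ir.sub is).const_mul _).sub ((ib.sub ia).const_mul _)).const_mul _
  · rw [i3, i1]
    simp only [hπ]
    field_simp
    ring
  · have hux : lam * μ * u x = g / 4 * (a x + b x) - lam ^ 2 / 2 * (r x + s x) := by
      linarith [hu x]
    rw [i2, (dπ x).deriv]
    simp only []
    rw [show lam * μ * (k ^ 2 * ψ x - (k ^ 2 * ψ x - u x)) = lam * μ * u x by ring, hux]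
    simp only [hψ]
    field_simp
    ring

/-! ### From the vertical mode to the full system. -/

/-- With horizontal velocity -ξ ψ'/|ξ|², both horizontal equations reduce to the formula for π,
multiplied by a component of ξ, and the divergence equation to |ξ|² = ξ₀² + ξ₁². -/
theorem HasL2Derivs.isNormalModeSolution {ρ ψ π : ℝ → ℝ} {μ g lam : ℝ}
    {ξ : EuclideanSpace ℝ (Fin 2)} (hξ : 0 < ‖ξ‖)
    (hψ : ∀ n, HasL2Derivs n ψ) (hπ : ∀ n, HasL2Derivs n π)
    (hπeq : ∀ x, π x
      = (μ * iteratedDeriv 3 ψ x - (lam * ρ x + μ * ‖ξ‖ ^ 2) * deriv ψ x) / ‖ξ‖ ^ 2)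
    (hψeq : ∀ x, lam ^ 2 * ρ x * ψ x + lam * deriv π x
      + lam * μ * (‖ξ‖ ^ 2 * ψ x - iteratedDeriv 2 ψ x) = g * deriv ρ x * ψ x) :
    IsNormalModeSolution ρ μ g ξ lam (fun x => -(ξ 0 / ‖ξ‖ ^ 2) * deriv ψ x)
      (fun x => -(ξ 1 / ‖ξ‖ ^ 2) * deriv ψ x) ψ π := by
  have hc : ∀ (c : ℝ) n, HasL2Derivs n (fun x => c * deriv ψ x) := fun c n =>
    (hasL2Derivs_deriv hψ n).const_mul c
  have h2 : ∀ (c x : ℝ), iteratedDeriv 2 (fun x => c * deriv ψ x) x = c * iteratedDeriv 3 ψ x :=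
    fun c x => by simp [iteratedDeriv_succ]
  refine ⟨(hc _ 2).contDiff, (hc _ 2).contDiff, (hψ 2).contDiff, (hπ 1).contDiff, fun x => ?_,
    fun x => ?_, hψeq, fun x => ?_, (hc _ 1).tendsto_atBot, (hc _ 1).tendsto_atTop,
    (hc _ 1).tendsto_atBot, (hc _ 1).tendsto_atTop, (hψ 1).tendsto_atBot, (hψ 1).tendsto_atTop⟩
  · rw [h2, hπeq]
    field_simp
    ring
  · rw [h2, hπeq]
    field_simp
    ring
  · have h : ‖ξ‖ ^ 2 = ξ 0 ^ 2 + ξ 1 ^ 2 := by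
      rw [EuclideanSpace.real_norm_sq_eq, Fin.sum_univ_two]
    have h' : ξ 0 ^ 2 + ξ 1 ^ 2 ≠ 0 := by rw [← h]; positivity
    simp only [h]
    field_simp
    ring

theorem theorem2p2 (ρ : ℝ → ℝ) (hρ : IsRTProfile ρ) (μ g : ℝ) (hμ : 0 < μ) (hg : 0 < g) :
    ∃ (lam : ℝ → ℝ) (ψ π : ℝ → ℝ → ℝ) (φ θ : EuclideanSpace ℝ (Fin 2) → ℝ → ℝ),
      ∀ ξ : EuclideanSpace ℝ (Fin 2), 0 < ‖ξ‖ →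
        0 < lam ‖ξ‖ ∧
        (∃ x, ψ ‖ξ‖ x ≠ 0) ∧
        IsNormalModeSolution ρ μ g ξ (lam ‖ξ‖) (φ ξ) (θ ξ) (ψ ‖ξ‖) (π ‖ξ‖) ∧
        (ContDiff ℝ ∞ (φ ξ) ∧ ContDiff ℝ ∞ (θ ξ) ∧
          ContDiff ℝ ∞ (ψ ‖ξ‖) ∧ ContDiff ℝ ∞ (π ‖ξ‖)) ∧
        (∀ k : ℕ, MemHk k (φ ξ) ∧ MemHk k (θ ξ) ∧ MemHk k (ψ ‖ξ‖) ∧ MemHk k (π ‖ξ‖)) ∧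
        (∀ x, π ‖ξ‖ x = (μ * iteratedDeriv 3 (ψ ‖ξ‖) x
          - (lam ‖ξ‖ * ρ x + μ * ‖ξ‖ ^ 2) * deriv (ψ ‖ξ‖) x) / ‖ξ‖ ^ 2) ∧
        (∀ x, φ ξ x = -(ξ 0 * deriv (ψ ‖ξ‖) x) / ‖ξ‖ ^ 2) ∧
        (∀ x, θ ξ x = -(ξ 1 * deriv (ψ ‖ξ‖) x) / ‖ξ‖ ^ 2) := by
  -- Choosing for each wave number k, before ξ appears, makes `lam`, `ψ` and `π` depend on ξ only
  -- through its norm; values at k ≤ 0 are arbitrary.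
  choose! lam hlam ψ π hψ0 hψ hπ hπeq hψeq using
    fun (k : ℝ) (hk : 0 < k) => hρ.exists_vertical_mode hμ hg hk
  refine ⟨lam, ψ, π, fun ξ x => -(ξ 0 / ‖ξ‖ ^ 2) * deriv (ψ ‖ξ‖) x,
    fun ξ x => -(ξ 1 / ‖ξ‖ ^ 2) * deriv (ψ ‖ξ‖) x, fun ξ hξ => ?_⟩
  have hc : ∀ (c : ℝ) n, HasL2Derivs n (fun x => c * deriv (ψ ‖ξ‖) x) := fun c n =>
    (hasL2Derivs_deriv (hψ _ hξ) n).const_mul c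
  refine ⟨hlam _ hξ, hψ0 _ hξ,
    HasL2Derivs.isNormalModeSolution hξ (hψ _ hξ) (hπ _ hξ) (hπeq _ hξ) (hψeq _ hξ),
    ⟨contDiff_infty_of_hasL2Derivs (hc _), contDiff_infty_of_hasL2Derivs (hc _),
      contDiff_infty_of_hasL2Derivs (hψ _ hξ), contDiff_infty_of_hasL2Derivs (hπ _ hξ)⟩,
    fun k => ⟨memHk_of_hasL2Derivs (hc _) k, memHk_of_hasL2Derivs (hc _) k,
      memHk_of_hasL2Derivs (hψ _ hξ) k, memHk_of_hasL2Derivs (hπ _ hξ) k⟩,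
    hπeq _ hξ, fun x => by ring, fun x => by ring⟩
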